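/- Consider the linear impulsive system with constant delays $h_c>0$ and $h_d\in\mathbb{Z}_{\ge0}$ $$\dot x(t_k+\tau)=A(\tau)x(t_k+\tau)+G_c(\tau)x(t_k+\tau-h_c)+E_c(\tau)w_c(t_k+\tau),\qquad z_c(t_k+\tau)=C_cx(t_k+\tau)+H_cx(t_k+\tau-h_c)+F_cw_c(t_k+\tau),$$ for $\tau\in(0,T_k]$, $k\ge0$, and $$x(t_k^+)=Jx(t_k)+G_dx(t_{k-h_d})+E_dw_d(k),\qquad z_d(k)=C_dx(t_k)+H_dx(t_{k-h_d})+F_dw_d(k),\qquad k\ge1,$$ where $x(t)\in\mathbb{R}^n$, $t_0=0$, there is no jump at $t_0$, $t_{k+1}=t_k+T_k$ with dwell-times $T_k>0$ and $t_k\to\infty$, and $A,G_c,E_c$ are continuous on $[0,\infty)$ (the other matrices are constant). The initial data are $\phi\in C([-h_c,0],\mathbb{R}^n)$, with $x=\phi$ on $[-h_c,0]$, and $\psi=(x(t_{-1}),\dots,x(t_{-h_d}))\in(\mathbb{R}^n)^{h_d}$, with the sup norm $\|(\phi,\psi)\|$. Solutions are left-continuous and understood in the Carathéodory sense. The system is internally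 positive if, for all delays $h_c>0$, $h_d\ge0$ and all such sequences of dwell-times, nonnegative initial data and nonnegative inputs $w_c$ (locally integrable), $w_d$ give $x(t)\ge0$ for $t\ge0$, $z_c(t)\ge0$ for $t>0$ and $z_d(k)\ge0$ for $k\ge1$ (all inequalities between vectors are componentwise). Let $0\le T_{\min}\le T_{\max}<\infty$ and, for $h_c>0$, let $\mathcal{T}_{RDT,p}(h_c)$ be the set of sequences $(T_k)_{k\ge0}$ of positive numbers for which there are positive integers $q,\alpha$ and $\beta_0,\dots,\beta_{q-1}\in[T_{\min},T_{\max}]$ with $T_{qi+k}=\beta_k$ for all $i\ge0$, $0\le k<q$, and $\sum_{i=0}^{q-1}T_i=h_c/\alpha$. Assume that the system is internally positive and that there are a differentiable $\zeta:[0,T_{\max}]\to\mathbb{R}^n$ with $\zeta(0)>0$ and scalars $\epsilon,\gamma>0$ such that, for all $\tau\in[0,T_{\max}]$ and $\theta\in[T_{\min},T_{\max}]$, with $\mathbb{1}$ a vector of ones, $$\dot\zeta(\tau)^T+\zeta(\tau)^T(A(\tau)+G_c(\tau))+\mathbb{1}^T(C_c+H_c)\le0,\qquad \zeta(\tau)^TE_c(\tau)+\mathbb{1}^TF_c\le\gamma\mathbb{1}^T,$$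 $$-\zeta(\theta)^T+\zeta(0)^T(J+G_d)+\mathbb{1}^T(C_d+H_d)\le-\epsilon\mathbb{1}^T,\qquad \zeta(0)^TE_d+\mathbb{1}^TF_d\le\gamma\mathbb{1}^T .$$ Then, for all delays $h_c>0$ and $h_d\in\mathbb{Z}_{\ge0}$: (1) The system is asymptotically stable for all sequences in $\mathcal{T}_{RDT,p}(h_c)$: for $w_c\equiv0$, $w_d\equiv0$, for every $\eta>0$ there is $\delta>0$ such that, for every sequence in $\mathcal{T}_{RDT,p}(h_c)$, $\|(\phi,\psi)\|<\delta$ implies $\|x(t)\|<\eta$ for all $t\ge0$; and for every sequence in $\mathcal{T}_{RDT,p}(h_c)$ every solution satisfies $x(t)\to0$ as $t\to\infty$. (2) The map $(w_c,w_d)\mapsto(z_c,z_d)$ has a hybrid $L_1/\ell_1$-gain of at most $\gamma$: there is an increasing function $v$ on $[0,\infty)$ with $v(0)=0$ and $v(s)\to\infty$ as $s\to\infty$ such that, for all sequences in $\mathcal{T}_{RDT,p}(h_c)$, all $w_c\in L_1$, $w_d\in\ell_1$, all initial data and the corresponding solutions, $$\|z_c\|_{L_1}+\|z_d\|_{\ell_1}\le\gamma\left(\|w_c\|_{L_1}+\|w_d\|_{\ell_1}\right)+v(\|(\phi,\psi)\|),$$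 where $\|f\|_{L_1}=\int_0^\infty\sum_i|f_i(t)|\,dt$ and $\|g\|_{\ell_1}=\sum_{k\ge1}\sum_i|g_i(k)|$. -/

import Mathlib

open Set Filter Topology MeasureTheory Matrix
open scoped ENNReal

namespace ImpulsiveDelay

/-- Matrices of a linear impulsive system with delays, with state dimension `n`, continuous- and
discrete-time input dimensions `pc`, `pd` and output dimensions `qc`, `qd`.  The matrices
`A`, `Gc`, `Ec` depend on the timer, that is, on the time elapsed since the last impulse. -/
structure Sys (n pc pd qc qd : ℕ) where
  A : ℝ → Matrix (Fin n) (Fin n) ℝ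
  Gc : ℝ → Matrix (Fin n) (Fin n) ℝ
  Ec : ℝ → Matrix (Fin n) (Fin pc) ℝ
  Cc : Matrix (Fin qc) (Fin n) ℝ
  Hc : Matrix (Fin qc) (Fin n) ℝ
  Fc : Matrix (Fin qc) (Fin pc) ℝ
  J : Matrix (Fin n) (Fin n) ℝ
  Gd : Matrix (Fin n) (Fin n) ℝ
  Ed : Matrix (Fin n) (Fin pd) ℝ
  Cd : Matrix (Fin qd) (Fin n) ℝ
  Hd : Matrix (Fin qd) (Fin n) ℝ
  Fd : Matrix (Fin qd) (Fin pd) ℝ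

/-- The impulse times `t_k = T_0 + ⋯ + T_{k-1}` (so `t_0 = 0`) of a sequence of dwell-times. -/
noncomputable def impulseTime (T : ℕ → ℝ) (k : ℕ) : ℝ := ∑ i ∈ Finset.range k, T i

/-- Admissible sequences of dwell-times: `T_k > 0` for all `k`, and `t_k → ∞`. -/
def IsDwellSeq (T : ℕ → ℝ) : Prop :=
  (∀ k, 0 < T k) ∧ Tendsto (impulseTime T) atTop atTop

variable {n pc pd qc qd : ℕ}

/-- The delayed sample `x(t_{k-h_d})`.  Samples with negative index are part of the initial data:
`ψ m` stands for `x(t_{-1-m})`, `0 ≤ m < h_d`. -/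
noncomputable def delayedSample (hd : ℕ) (T : ℕ → ℝ) (ψ : Fin hd → Fin n → ℝ)
    (x : ℝ → Fin n → ℝ) (k : ℕ) : Fin n → ℝ :=
  if h : hd ≤ k then x (impulseTime T (k - hd)) else ψ ⟨hd - k - 1, by omega⟩

/-- The right limit `x(t_k⁺)`: there is no jump at `t_0 = 0`, and at `t_k`, `k ≥ 1`, it is
`J x(t_k) + G_d x(t_{k-h_d}) + E_d w_d(k)`. -/
noncomputable def Sys.afterJump (S : Sys n pc pd qc qd) (hd : ℕ) (T : ℕ → ℝ)
    (ψ : Fin hd → Fin n → ℝ) (wd : ℕ → Fin pd → ℝ) (x : ℝ → Fin n → ℝ) (k : ℕ) : Fin n → ℝ :=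
  if k = 0 then x 0
  else S.J *ᵥ x (impulseTime T k) + S.Gd *ᵥ delayedSample hd T ψ x k + S.Ed *ᵥ wd k

/-- The right-hand side `A(τ) x(t_k+τ) + G_c(τ) x(t_k+τ-h_c) + E_c(τ) w_c(t_k+τ)`. -/
noncomputable def Sys.flow (S : Sys n pc pd qc qd) (hc : ℝ) (T : ℕ → ℝ)
    (wc : ℝ → Fin pc → ℝ) (x : ℝ → Fin n → ℝ) (k : ℕ) (τ : ℝ) : Fin n → ℝ :=
  S.A τ *ᵥ x (impulseTime T k + τ) + S.Gc τ *ᵥ x (impulseTime T k + τ - hc)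
    + S.Ec τ *ᵥ wc (impulseTime T k + τ)

/-- `x` is a trajectory, on `[-h_c, ∞)`, of the system with delays `h_c`, `h_d`, dwell-times `T`,
initial data `φ`, `ψ` and inputs `w_c`, `w_d`.  Trajectories are left-continuous, and the
differential equation on `(t_k, t_{k+1}]` is understood in the sense of Carathéodory, in
integrated form. -/
structure Sys.IsTrajectory (S : Sys n pc pd qc qd) (hc : ℝ) (hd : ℕ) (T : ℕ → ℝ)
    (φ : C(Icc (-hc) 0, Fin n → ℝ)) (ψ : Fin hd → Fin n → ℝ)
    (wc : ℝ → Fin pc → ℝ) (wd : ℕ → Fin pd → ℝ) (x : ℝ → Fin n → ℝ) : Prop where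
  init : ∀ s : Icc (-hc) 0, x s = φ s
  integrable : ∀ k, IntervalIntegrable (S.flow hc T wc x k) volume 0 (T k)
  eq : ∀ k, ∀ τ ∈ Ioc 0 (T k), x (impulseTime T k + τ) =
    S.afterJump hd T ψ wd x k + ∫ s in (0 : ℝ)..τ, S.flow hc T wc x k s

/-- The continuous-time output `z_c(t) = C_c x(t) + H_c x(t-h_c) + F_c w_c(t)`, `t > 0`. -/
noncomputable def Sys.zc (S : Sys n pc pd qc qd) (hc : ℝ) (wc : ℝ → Fin pc → ℝ)
    (x : ℝ → Fin n → ℝ) (t : ℝ) : Fin qc → ℝ :=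
  S.Cc *ᵥ x t + S.Hc *ᵥ x (t - hc) + S.Fc *ᵥ wc t

/-- The discrete-time output `z_d(k) = C_d x(t_k) + H_d x(t_{k-h_d}) + F_d w_d(k)`, `k ≥ 1`. -/
noncomputable def Sys.zd (S : Sys n pc pd qc qd) (hd : ℕ) (T : ℕ → ℝ)
    (ψ : Fin hd → Fin n → ℝ) (wd : ℕ → Fin pd → ℝ) (x : ℝ → Fin n → ℝ) (k : ℕ) : Fin qd → ℝ :=
  S.Cd *ᵥ x (impulseTime T k) + S.Hd *ᵥ delayedSample hd T ψ x k + S.Fd *ᵥ wd k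

/-- Internal positivity: for all delays and all admissible dwell-times, nonnegative initial data
and nonnegative inputs give a nonnegative state and nonnegative outputs. -/
def Sys.InternallyPositive (S : Sys n pc pd qc qd) : Prop :=
  ∀ (hc : ℝ) (hd : ℕ) (T : ℕ → ℝ), 0 < hc → IsDwellSeq T →
  ∀ (φ : C(Icc (-hc) 0, Fin n → ℝ)) (ψ : Fin hd → Fin n → ℝ)
    (wc : ℝ → Fin pc → ℝ) (wd : ℕ → Fin pd → ℝ) (x : ℝ → Fin n → ℝ),
    LocallyIntegrableOn wc (Ici 0) → S.IsTrajectory hc hd T φ ψ wc wd x →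
    (∀ s, 0 ≤ φ s) → (∀ m, 0 ≤ ψ m) → (∀ t, 0 ≤ t → 0 ≤ wc t) → (∀ k, 1 ≤ k → 0 ≤ wd k) →
    (∀ t, 0 ≤ t → 0 ≤ x t) ∧ (∀ t, 0 < t → 0 ≤ S.zc hc wc x t) ∧
      (∀ k, 1 ≤ k → 0 ≤ S.zd hd T ψ wd x k)

/-- Periodic sequences of dwell-times `T_{qi+k} = β_k ∈ [T_min, T_max]`, `0 ≤ k < q`, `i ≥ 0`, with
`T_0 + ⋯ + T_{q-1} = h_c / α` for some positive integers `q`, `α`. -/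
def periodicRangeDwell (Tmin Tmax hc : ℝ) : Set (ℕ → ℝ) :=
  {T | (∀ k, 0 < T k) ∧ ∃ (q α : ℕ) (β : ℕ → ℝ), 0 < q ∧ 0 < α ∧
    (∀ k < q, β k ∈ Icc Tmin Tmax) ∧ (∀ i, ∀ k < q, T (q * i + k) = β k) ∧
    ∑ i ∈ Finset.range q, T i = hc / α}

/-- Asymptotic stability of the unforced system with delays `h_c`, `h_d`, for all sequences of
dwell-times in `𝒯`: Lyapunov stability (uniform in the sequence) and global attractivity. -/
def Sys.AsymptoticallyStable (S : Sys n pc pd qc qd) (hc : ℝ) (hd : ℕ)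
    (𝒯 : Set (ℕ → ℝ)) : Prop :=
  (∀ ε > 0, ∃ δ > 0, ∀ T ∈ 𝒯, ∀ (φ : C(Icc (-hc) 0, Fin n → ℝ)) (ψ : Fin hd → Fin n → ℝ)
    (x : ℝ → Fin n → ℝ), S.IsTrajectory hc hd T φ ψ 0 0 x → ‖(φ, ψ)‖ < δ →
    ∀ t, 0 ≤ t → ‖x t‖ < ε) ∧
  (∀ T ∈ 𝒯, ∀ (φ : C(Icc (-hc) 0, Fin n → ℝ)) (ψ : Fin hd → Fin n → ℝ)
    (x : ℝ → Fin n → ℝ), S.IsTrajectory hc hd T φ ψ 0 0 x → Tendsto x atTop (𝓝 0))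

/-- The `L₁` norm on `(0, ∞)` of a vector-valued function: the integral of `∑ i, |f_i|`. -/
noncomputable def normL1 {m : ℕ} (f : ℝ → Fin m → ℝ) : ℝ≥0∞ :=
  ∫⁻ t in Ioi (0 : ℝ), ∑ i, ‖f t i‖ₑ

/-- The `ℓ₁` norm over `k ≥ 1` of a sequence of vectors. -/
noncomputable def normEll1 {m : ℕ} (f : ℕ → Fin m → ℝ) : ℝ≥0∞ :=
  ∑' k : ℕ, ∑ i, ‖f (k + 1) i‖ₑ

/-- Hybrid `L₁/ℓ₁`-gain of at most `γ`, with a bias function of the size of the initial data, for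
all sequences of dwell-times in `𝒯`.  In particular `z_c` and `z_d` have finite norms. -/
def Sys.HasHybridGainAtMost (S : Sys n pc pd qc qd) (hc : ℝ) (hd : ℕ)
    (𝒯 : Set (ℕ → ℝ)) (γ : ℝ) : Prop :=
  ∃ v : ℝ → ℝ, StrictMonoOn v (Ici 0) ∧ v 0 = 0 ∧ Tendsto v atTop atTop ∧
    ∀ T ∈ 𝒯, ∀ (φ : C(Icc (-hc) 0, Fin n → ℝ)) (ψ : Fin hd → Fin n → ℝ)
      (wc : ℝ → Fin pc → ℝ) (wd : ℕ → Fin pd → ℝ) (x : ℝ → Fin n → ℝ),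
      IntegrableOn wc (Ioi 0) → normEll1 wd < ∞ → S.IsTrajectory hc hd T φ ψ wc wd x →
      normL1 (S.zc hc wc x) + normEll1 (S.zd hd T ψ wd x) ≤
        ENNReal.ofReal γ * (normL1 wc + normEll1 wd) + ENNReal.ofReal (v ‖(φ, ψ)‖)

end ImpulsiveDelay

/-! For nonnegative trajectories a linear functional serves as Lyapunov function. Let κ(τ) =
ζ(τ)ᵀG_c(τ) + 1ᵀH_c and λ = ζ(0)ᵀG_d + 1ᵀH_d (`flowWeight`, `jumpWeight`). Differentiating ζ(τ)ᵀx
along a dwell interval and adding the jump condition at θ = T_k bounds the increase of ζ(0)ᵀx(t_k⁺)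
by γ·(inputs) − (outputs) − ε1ᵀx(t_{k+1}), plus κ- and λ-weighted delayed terms, minus the same
weights on the undelayed state (`flow_inequality`, `jump_inequality`). A whole number N of
dwell-times adds up to h_c, so t and t − h_c carry the same timer value: the κ-terms are a sequence
and its shift by N, the λ-terms a sequence and its shift by h_d. Summation over k cancels them up to
initial data (`sum_le_of_nonneg`), which gives both the gain and the summability of x(t_k).

The cancellation needs κ, λ ≥ 0. Test trajectories of the positive system give the signs of the
constant matrices and of the kernel Φ(τ)Φ(s)⁻¹G_c(s), where Φ is the fundamental matrix of ẋ = Ax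
(`entries_nonneg`, `kernel_nonneg`). Since ζ itself has no assumed sign inside the interval, ζᵀG_c ≥
0 comes from a backward Gronwall argument started at ζ(T_max) > 0 (`vecMul_Gc_nonneg`). The same
kernel bounds x between impulses by its value at the next impulse (`exists_norm_le`), so that decay
of x(t_k) gives decay of x.

Signed data are split into positive and negative parts, and the trajectory into a difference of two
nonnegative ones (`exists_eq_sub`). The splitting preserves the L₁ norm of the inputs exactly, hence
the constant γ. -/

namespace ImpulsiveDelay

/-! ### Calculus of indefinite integrals. -/

/-- `u` is, on `[0, b]`, an indefinite integral of the integrable function `u'`. -/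
def IsPrimitive (b : ℝ) (u u' : ℝ → ℝ) : Prop :=
  IntervalIntegrable u' volume 0 b ∧ ∀ t ∈ Icc 0 b, u t = u 0 + ∫ s in (0 : ℝ)..t, u' s

namespace IsPrimitive

variable {b : ℝ} {u u' v v' : ℝ → ℝ}

lemma intervalIntegrable_of_mem {f : ℝ → ℝ} (h : IntervalIntegrable f volume 0 b) {s t : ℝ}
    (hs : s ∈ Icc 0 b) (ht : t ∈ Icc 0 b) : IntervalIntegrable f volume s t := by
  refine h.mono_set ?_
  rw [uIcc_of_le (hs.1.trans hs.2)]
  exact uIcc_subset_Icc hs ht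

lemma sub_eq (h : IsPrimitive b u u') {s t : ℝ} (hs : s ∈ Icc 0 b) (ht : t ∈ Icc 0 b) :
    u t - u s = ∫ r in s..t, u' r := by
  have h0 : (0 : ℝ) ∈ Icc 0 b := ⟨le_rfl, hs.1.trans hs.2⟩
  rw [h.2 t ht, h.2 s hs, ← intervalIntegral.integral_interval_sub_left
    (intervalIntegrable_of_mem h.1 h0 ht) (intervalIntegrable_of_mem h.1 h0 hs)]
  ring

lemma mono (h : IsPrimitive b u u') {c : ℝ} (hc : c ∈ Icc 0 b) : IsPrimitive c u u' :=
  ⟨intervalIntegrable_of_mem h.1 ⟨le_rfl, hc.1.trans hc.2⟩ hc,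
    fun t ht => h.2 t ⟨ht.1, ht.2.trans hc.2⟩⟩

lemma congr_deriv (h : IsPrimitive b u u') (hb : 0 ≤ b) (huv : ∀ t ∈ Ioc 0 b, u' t = v' t) :
    IsPrimitive b u v' := by
  refine ⟨h.1.congr fun t ht => huv t (by rwa [uIoc_of_le hb] at ht), fun t ht => ?_⟩
  rw [h.2 t ht]
  congr 1
  refine intervalIntegral.integral_congr_ae (ae_of_all _ fun s hs => huv s ?_)
  rw [uIoc_of_le ht.1] at hs
  exact ⟨hs.1, hs.2.trans ht.2⟩

lemma congr (h : IsPrimitive b u u') (hb : 0 ≤ b) (huv : ∀ t ∈ Icc 0 b, u t = v t) :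
    IsPrimitive b v u' :=
  ⟨h.1, fun t ht => by rw [← huv t ht, ← huv 0 ⟨le_rfl, hb⟩, h.2 t ht]⟩

lemma const (b c : ℝ) : IsPrimitive b (fun _ => c) (fun _ => 0) := by
  refine ⟨by simp, fun t _ => by simp⟩

lemma of_integral {f : ℝ → ℝ} (hf : IntervalIntegrable f volume 0 b) (c : ℝ) :
    IsPrimitive b (fun t => c + ∫ s in (0 : ℝ)..t, f s) f :=
  ⟨hf, fun t _ => by simp⟩

lemma add (hu : IsPrimitive b u u') (hv : IsPrimitive b v v') :
    IsPrimitive b (fun t => u t + v t) (fun t => u' t + v' t) := by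
  refine ⟨hu.1.add hv.1, fun t ht => ?_⟩
  have h0 : (0 : ℝ) ∈ Icc 0 b := ⟨le_rfl, ht.1.trans ht.2⟩
  rw [intervalIntegral.integral_add (intervalIntegrable_of_mem hu.1 h0 ht)
    (intervalIntegrable_of_mem hv.1 h0 ht)]
  simp only [hu.2 t ht, hv.2 t ht]
  ring

lemma sum {ι : Type*} (s : Finset ι) {u u' : ι → ℝ → ℝ} (h : ∀ i ∈ s, IsPrimitive b (u i) (u' i)) :
    IsPrimitive b (fun t => ∑ i ∈ s, u i t) (fun t => ∑ i ∈ s, u' i t) := by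
  classical
  induction s using Finset.induction_on with
  | empty => simpa using const b 0
  | insert i s hi ih =>
    simp only [Finset.sum_insert hi]
    exact (h i (Finset.mem_insert_self i s)).add
      (ih fun j hj => h j (Finset.mem_insert_of_mem hj))

/-- Stated for the integral representative, because its almost-everywhere derivative is the one
known to be `u'`; `u` is arbitrary outside `[0, b]`. -/
lemma absolutelyContinuousOnInterval (h : IsPrimitive b u u') :
    AbsolutelyContinuousOnInterval (fun t => u 0 + ∫ s in (0 : ℝ)..t, u' s) 0 b := by
  have h1 := h.1.absolutelyContinuousOnInterval_intervalIntegral (c := 0) (by simp)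
  have h2 : AbsolutelyContinuousOnInterval (fun _ : ℝ => u 0) 0 b :=
    (LipschitzWith.const (u 0)).lipschitzOnWith.absolutelyContinuousOnInterval
  exact h2.fun_add h1

lemma continuousOn (h : IsPrimitive b u u') (hb : 0 ≤ b) : ContinuousOn u (Icc 0 b) := by
  have := h.absolutelyContinuousOnInterval.continuousOn
  rw [uIcc_of_le hb] at this
  exact this.congr h.2

/-- Integration by parts for absolutely continuous functions: by Lebesgue differentiation the
product rule holds almost everywhere. -/
lemma mul (hu : IsPrimitive b u u') (hv : IsPrimitive b v v') (hb : 0 ≤ b) :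
    IsPrimitive b (fun t => u t * v t) (fun t => u' t * v t + u t * v' t) := by
  have hcu := hu.continuousOn hb
  have hcv := hv.continuousOn hb
  rw [← uIcc_of_le hb] at hcu hcv
  refine ⟨(hu.1.mul_continuousOn hcv).add (hv.1.continuousOn_mul hcu), fun t ht => ?_⟩
  have hut := hu.mono ht
  have hvt := hv.mono ht
  have key := hut.absolutelyContinuousOnInterval.integral_deriv_mul_eq_sub
    hvt.absolutelyContinuousOnInterval
  simp only [intervalIntegral.integral_same, add_zero] at key
  rw [← hu.2 t ht, ← hv.2 t ht] at key
  have : ∫ s in (0 : ℝ)..t, (u' s * v s + u s * v' s) = u t * v t - u 0 * v 0 := by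
    rw [← key]
    apply intervalIntegral.integral_congr_ae
    filter_upwards [hut.1.ae_hasDerivAt_integral, hvt.1.ae_hasDerivAt_integral] with s h1 h2 hs
    have hs' : s ∈ uIcc 0 t := uIoc_subset_uIcc hs
    have e1 := ((h1 hs' 0 (by simp)).const_add (u 0)).deriv
    have e2 := ((h2 hs' 0 (by simp)).const_add (v 0)).deriv
    rw [uIcc_of_le ht.1] at hs'
    rw [e1, e2, ← hut.2 s hs', ← hvt.2 s hs']
  rw [this]
  ring

/-- A continuous function on `[0, b]`, differentiable inside with a derivative bounded above by a
continuous function, is an indefinite integral of its derivative. -/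
lemma of_hasDerivAt_le (hb : 0 ≤ b) (hu : ContinuousOn u (Icc 0 b))
    (hderiv : ∀ t ∈ Ioo 0 b, HasDerivAt u (u' t) t) {g : ℝ → ℝ} (hg : Continuous g)
    (hle : ∀ t ∈ Ioo 0 b, u' t ≤ g t) : IsPrimitive b u u' := by
  have hG : ∀ t, HasDerivAt (fun t => ∫ s in (0 : ℝ)..t, g s) (g t) t := fun t =>
    intervalIntegral.integral_hasDerivAt_right (hg.intervalIntegrable _ _)
      (hg.stronglyMeasurableAtFilter _ _) hg.continuousAt
  -- The difference `g - u'` is a nonnegative derivative of a continuous function, hence integrable;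
  -- this transfers to `u'`, and the fundamental theorem of calculus applies.
  have hint : IntervalIntegrable (fun t => g t - u' t) volume 0 b := by
    refine intervalIntegral.intervalIntegrable_deriv_of_nonneg
      (g := fun t => (∫ s in (0 : ℝ)..t, g s) - u t) ?_ ?_ ?_
    · rw [uIcc_of_le hb]
      exact (continuous_iff_continuousAt.2 fun t => (hG t).continuousAt).continuousOn.sub hu
    · rw [min_eq_left hb, max_eq_right hb]
      exact fun t ht => (hG t).sub (hderiv t ht)
    · rw [min_eq_left hb, max_eq_right hb]
      exact fun t ht => sub_nonneg.2 (hle t ht)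
  have hint' : IntervalIntegrable u' volume 0 b := by
    have := (hg.intervalIntegrable 0 b).sub hint
    simpa using this
  refine ⟨hint', fun t ht => ?_⟩
  rw [intervalIntegral.integral_eq_sub_of_hasDerivAt_of_le ht.1
    (hu.mono (Icc_subset_Icc_right ht.2))
    (fun s hs => hderiv s ⟨hs.1, hs.2.trans_le ht.2⟩)
    (intervalIntegrable_of_mem hint' ⟨le_rfl, hb⟩ ht)]
  ring

end IsPrimitive

/-! ### Existence for Lipschitz differential equations. -/

/-- Global existence for ordinary differential equations with a Lipschitz right-hand side. -/
theorem exists_integral_curve {E : Type*} [NormedAddCommGroup E] [NormedSpace ℝ E]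
    [CompleteSpace E] {F : ℝ → E → E} (hF : Continuous (Function.uncurry F)) {b K : ℝ}
    (hb : 0 ≤ b) (hK : 0 ≤ K) (hL : ∀ t ∈ Icc 0 b, ∀ x y, ‖F t x - F t y‖ ≤ K * ‖x - y‖) (y₀ : E) :
    ∃ y : ℝ → E, Continuous y ∧ ∀ t ∈ Icc 0 b, y t = y₀ + ∫ s in (0 : ℝ)..t, F s (y s) := by
  -- In the sup norm weighted by `exp (-l t)` the Picard operator has Lipschitz constant at most `K
  -- / l ≤ 1 / 2`. The unknown `u` is the rescaled curve `exp (-l t) • y t`, so the plain norm of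
  -- `C([0, b], E)` is this weighted norm.
  set l : ℝ := 2 * (K + 1) with hl
  have hlpos : 0 < l := by positivity
  let ext : C(Icc (0 : ℝ) b, E) → ℝ → E := fun u t => Real.exp (l * t) • IccExtend hb u t
  have hext : ∀ u, Continuous (ext u) := fun u => by
    have : Continuous (IccExtend hb u) := u.continuous.Icc_extend'
    fun_prop
  have hFc : ∀ u, Continuous fun s => F s (ext u s) := fun u =>
    hF.comp (continuous_id.prodMk (hext u))
  let P : C(Icc (0 : ℝ) b, E) → ℝ → E := fun u t => y₀ + ∫ s in (0 : ℝ)..t, F s (ext u s)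
  have hP : ∀ u, Continuous (P u) := fun u =>
    continuous_const.add (intervalIntegral.continuous_primitive
      (fun a c => (hFc u).intervalIntegrable a c) 0)
  let S : C(Icc (0 : ℝ) b, E) → C(Icc (0 : ℝ) b, E) := fun u =>
    ⟨fun t => Real.exp (-(l * t)) • P u t, by
      have := hP u
      fun_prop⟩
  have hexpint : ∀ t : ℝ, ∫ s in (0 : ℝ)..t, Real.exp (l * s) = l⁻¹ * (Real.exp (l * t) - 1) := by
    intro t
    rw [intervalIntegral.integral_comp_mul_left (fun s => Real.exp s) hlpos.ne']
    simp
  have hS : ContractingWith (1 / 2) S := by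
    refine ⟨by norm_num, LipschitzWith.of_dist_le_mul fun u v => ?_⟩
    rw [ContinuousMap.dist_le (by positivity)]
    rintro ⟨t, ht⟩
    have hsub : P u t - P v t = ∫ s in (0 : ℝ)..t, (F s (ext u s) - F s (ext v s)) := by
      rw [intervalIntegral.integral_sub ((hFc u).intervalIntegrable _ _)
        ((hFc v).intervalIntegrable _ _)]
      simp only [P]
      abel
    have hbound : ‖P u t - P v t‖ ≤ ∫ s in (0 : ℝ)..t, K * dist u v * Real.exp (l * s) := by
      rw [hsub]
      refine intervalIntegral.norm_integral_le_of_norm_le ht.1 (ae_of_all _ fun s hs => ?_)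
        (Continuous.intervalIntegrable (by fun_prop) _ _)
      have hs' : s ∈ Icc 0 b := ⟨hs.1.le, hs.2.trans ht.2⟩
      refine (hL s hs' _ _).trans ?_
      rw [mul_assoc]
      refine mul_le_mul_of_nonneg_left ?_ hK
      simp only [ext]
      rw [← smul_sub, norm_smul, Real.norm_eq_abs, Real.abs_exp, mul_comm, ← dist_eq_norm]
      exact mul_le_mul_of_nonneg_right (ContinuousMap.dist_apply_le_dist _) (Real.exp_pos _).le
    rw [intervalIntegral.integral_const_mul, hexpint] at hbound
    change dist (Real.exp (-(l * t)) • P u t) (Real.exp (-(l * t)) • P v t) ≤ _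
    rw [dist_eq_norm, ← smul_sub, norm_smul, Real.norm_eq_abs, Real.abs_exp]
    calc Real.exp (-(l * t)) * ‖P u t - P v t‖
        ≤ Real.exp (-(l * t)) * (K * dist u v * (l⁻¹ * Real.exp (l * t))) := by
          refine mul_le_mul_of_nonneg_left (hbound.trans ?_) (Real.exp_pos _).le
          have : 0 ≤ l⁻¹ := by positivity
          gcongr
          linarith
      _ = K * l⁻¹ * dist u v := by
          rw [Real.exp_neg]
          field_simp
      _ ≤ _ := by
          refine mul_le_mul_of_nonneg_right ?_ dist_nonneg
          rw [← div_eq_mul_inv, div_le_iff₀ hlpos, hl]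
          push_cast
          linarith
  obtain ⟨u, hu⟩ : ∃ u, S u = u := ⟨_, hS.fixedPoint_isFixedPt⟩
  refine ⟨ext u, hext u, fun t ht => ?_⟩
  have h1 : Real.exp (-(l * t)) • P u t = u ⟨t, ht⟩ := congrArg (fun f => f ⟨t, ht⟩) hu
  simp only [ext]
  rw [IccExtend_of_mem hb _ ht, ← h1, smul_smul, ← Real.exp_add]
  simp [P, ext]

end ImpulsiveDelay

/-! ### Fundamental matrices and variation of constants. -/

namespace ImpulsiveDelay

lemma norm_mulVec_le {m n : ℕ} (M : Matrix (Fin m) (Fin n) ℝ) (z : Fin n → ℝ) :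
    ‖M *ᵥ z‖ ≤ (∑ i, ∑ j, |M i j|) * ‖z‖ := by
  refine (pi_norm_le_iff_of_nonneg (by positivity)).2 fun i => ?_
  calc ‖(M *ᵥ z) i‖ ≤ ∑ j, ‖M i j * z j‖ := norm_sum_le Finset.univ fun j => M i j * z j
    _ ≤ ∑ j, |M i j| * ‖z‖ := Finset.sum_le_sum fun j _ => by
        rw [norm_mul, Real.norm_eq_abs]
        exact mul_le_mul_of_nonneg_left (norm_le_pi_norm z j) (abs_nonneg _)
    _ = (∑ j, |M i j|) * ‖z‖ := (Finset.sum_mul _ _ _).symm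
    _ ≤ _ := by
        refine mul_le_mul_of_nonneg_right ?_ (norm_nonneg _)
        exact Finset.single_le_sum (f := fun i => ∑ j, |M i j|)
          (fun i _ => Finset.sum_nonneg fun j _ => abs_nonneg _) (Finset.mem_univ i)

lemma exists_sum_abs_le {m n : ℕ} {M : ℝ → Matrix (Fin m) (Fin n) ℝ} (b : ℝ) (hM : Continuous M) :
    ∃ K, 0 ≤ K ∧ ∀ t ∈ Icc 0 b, ∑ i, ∑ j, |M t i j| ≤ K := by
  have hc : Continuous fun t => ∑ i, ∑ j, |M t i j| := by
    refine continuous_finsetSum _ fun i _ => continuous_finsetSum _ fun j _ => ?_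
    exact (hM.matrix_elem i j).abs
  obtain ⟨K, hK⟩ := isCompact_Icc.exists_bound_of_continuousOn (s := Icc 0 b) hc.continuousOn
  refine ⟨max K 0, le_max_right _ _, fun t ht => ?_⟩
  exact (le_abs_self _).trans ((hK t ht).trans (le_max_left _ _))

lemma intervalIntegral_apply {ι : Type*} [Fintype ι] {f : ℝ → ι → ℝ} {a b : ℝ}
    (hf : IntervalIntegrable f volume a b) (i : ι) :
    (∫ s in a..b, f s) i = ∫ s in a..b, f s i :=
  ((ContinuousLinearMap.proj (R := ℝ) (φ := fun _ : ι => ℝ) i).intervalIntegral_comp_comm hf).symm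

lemma intervalIntegrable_apply {ι : Type*} [Fintype ι] {f : ℝ → ι → ℝ} {a b : ℝ}
    (hf : IntervalIntegrable f volume a b) (i : ι) :
    IntervalIntegrable (fun s => f s i) volume a b :=
  ⟨hf.1.eval i, hf.2.eval i⟩

lemma intervalIntegrable_of_apply {ι : Type*} [Fintype ι] {f : ℝ → ι → ℝ} {a b : ℝ}
    (hf : ∀ i, IntervalIntegrable (fun s => f s i) volume a b) :
    IntervalIntegrable f volume a b :=
  ⟨Integrable.of_eval fun i => (hf i).1, Integrable.of_eval fun i => (hf i).2⟩

lemma intervalIntegrable_finsetSum {ι : Type*} (s : Finset ι) {f : ι → ℝ → ℝ} {a b : ℝ}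
    (hf : ∀ i ∈ s, IntervalIntegrable (f i) volume a b) :
    IntervalIntegrable (fun t => ∑ i ∈ s, f i t) volume a b :=
  ⟨integrable_finsetSum s fun i hi => (hf i hi).1, integrable_finsetSum s fun i hi => (hf i hi).2⟩

lemma intervalIntegrable_mulVec_apply {m n : ℕ} {M : ℝ → Matrix (Fin m) (Fin n) ℝ}
    {f : ℝ → Fin n → ℝ} {a b : ℝ} (hf : ∀ i, IntervalIntegrable (fun s => f s i) volume a b)
    (hM : Continuous M) (i : Fin m) :
    IntervalIntegrable (fun t => (M t *ᵥ f t) i) volume a b :=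
  intervalIntegrable_finsetSum (f := fun j t => M t i j * f t j) Finset.univ fun j _ =>
    (hf j).continuousOn_mul (hM.matrix_elem i j).continuousOn

/-- `Φ` is the fundamental matrix on `[0, b]` of `ẋ = A x`, and `Ψ` is its inverse. -/
structure IsFundamentalPair {n : ℕ} (b : ℝ) (A Φ Ψ : ℝ → Matrix (Fin n) (Fin n) ℝ) : Prop where
  continuous : Continuous Φ
  continuous_inv : Continuous Ψ
  isPrimitive : ∀ i j, IsPrimitive b (fun t => Φ t i j) (fun t => (A t * Φ t) i j)
  isPrimitive_inv : ∀ i j, IsPrimitive b (fun t => Ψ t i j) (fun t => -(Ψ t * A t) i j)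
  zero : Φ 0 = 1
  zero_inv : Ψ 0 = 1
  inv_mul : ∀ t ∈ Icc 0 b, Ψ t * Φ t = 1
  mul_inv : ∀ t ∈ Icc 0 b, Φ t * Ψ t = 1

lemma exists_matrix_solution {n : ℕ} {A : ℝ → Matrix (Fin n) (Fin n) ℝ} (hA : Continuous A) {b : ℝ}
    (hb : 0 ≤ b) : ∃ Φ : ℝ → Matrix (Fin n) (Fin n) ℝ, Continuous Φ ∧ Φ 0 = 1 ∧
      ∀ i j, IsPrimitive b (fun t => Φ t i j) (fun t => (A t * Φ t) i j) := by
  obtain ⟨K, hK, hKA⟩ := exists_sum_abs_le b hA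
  have hcont : Continuous (Function.uncurry fun t (y : Fin n → ℝ) => A t *ᵥ y) :=
    (hA.comp continuous_fst).matrix_mulVec continuous_snd
  have h : ∀ j : Fin n, ∃ y : ℝ → Fin n → ℝ, Continuous y ∧ ∀ t ∈ Icc 0 b,
      y t = (1 : Matrix (Fin n) (Fin n) ℝ)ᵀ j + ∫ s in (0 : ℝ)..t, A s *ᵥ y s := fun j =>
    exists_integral_curve hcont hb hK (fun t ht x y => by
      rw [← mulVec_sub]
      exact (norm_mulVec_le _ _).trans (mul_le_mul_of_nonneg_right (hKA t ht) (norm_nonneg _))) _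
  choose y hy hyeq using h
  have hint : ∀ j t, IntervalIntegrable (fun s => A s *ᵥ y j s) volume 0 t := fun j t =>
    (hA.matrix_mulVec (hy j)).intervalIntegrable _ _
  refine ⟨fun t => of fun i j => y j t i, ?_, ?_, fun i j => ⟨?_, fun t ht => ?_⟩⟩
  · exact continuous_matrix fun i j => (continuous_apply i).comp (hy j)
  · ext i j
    have := congrFun (hyeq j 0 ⟨le_rfl, hb⟩) i
    simpa [one_apply, eq_comm] using this
  · exact intervalIntegrable_apply (hint j b) i
  · have h1 := congrFun (hyeq j t ht) i
    have h0 := congrFun (hyeq j 0 ⟨le_rfl, hb⟩) i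
    simp only [intervalIntegral.integral_same, add_zero] at h0
    simp only [Pi.add_apply, intervalIntegral_apply (hint j t) i] at h1
    simp only [of_apply]
    rw [h1, h0]
    rfl

/-- The inverse is the transpose of the solution of the adjoint equation `Θ' = -Aᵀ Θ`: the
derivative of `Θᵀ Φ` vanishes, so the product keeps its initial value 1. -/
theorem exists_isFundamentalPair {n : ℕ} {A : ℝ → Matrix (Fin n) (Fin n) ℝ} (hA : Continuous A)
    {b : ℝ} (hb : 0 ≤ b) : ∃ Φ Ψ, IsFundamentalPair b A Φ Ψ := by
  obtain ⟨Φ, hΦc, hΦ0, hΦ⟩ := exists_matrix_solution hA hb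
  obtain ⟨Θ, hΘc, hΘ0, hΘ⟩ := exists_matrix_solution (A := fun t => -(A t)ᵀ)
    hA.matrix_transpose.neg hb
  have hΨ : ∀ i j, IsPrimitive b (fun t => (Θ t)ᵀ i j) (fun t => -((Θ t)ᵀ * A t) i j) := by
    intro i j
    refine (hΘ j i).congr_deriv hb fun t _ => ?_
    have : -((Θ t)ᵀ * A t) = (-(A t)ᵀ * Θ t)ᵀ := by simp [transpose_mul]
    rw [← neg_apply, this, transpose_apply]
  have hprod : ∀ t ∈ Icc 0 b, (Θ t)ᵀ * Φ t = 1 := by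
    intro t ht
    ext i j
    have hp := (IsPrimitive.sum Finset.univ fun k _ => (hΨ i k).mul (hΦ k j) hb).congr_deriv
      (v' := fun _ => 0) hb fun t _ => by
        have : ∑ k, (-((Θ t)ᵀ * A t) i k * Φ t k j + (Θ t)ᵀ i k * (A t * Φ t) k j)
            = (-((Θ t)ᵀ * A t) * Φ t + (Θ t)ᵀ * (A t * Φ t)) i j := by
          rw [Finset.sum_add_distrib]
          rfl
        rw [this]
        simp [Matrix.mul_assoc]
    have h2 := hp.2 t ht
    simp only [intervalIntegral.integral_zero, add_zero] at h2
    have h3 : ((Θ t)ᵀ * Φ t) i j = ((Θ 0)ᵀ * Φ 0) i j := h2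
    rw [h3, hΘ0, hΦ0]
    simp
  exact ⟨Φ, fun t => (Θ t)ᵀ, hΦc, hΘc.matrix_transpose, hΦ, hΨ, hΦ0, by simp [hΘ0], hprod,
    fun t ht => mul_eq_one_comm.1 (hprod t ht)⟩

namespace IsFundamentalPair

variable {n : ℕ} {b : ℝ} {A Φ Ψ : ℝ → Matrix (Fin n) (Fin n) ℝ}

/-- Variation of constants. -/
lemma isPrimitive_inv_mulVec (h : IsFundamentalPair b A Φ Ψ) {c : ℝ} (hc : c ∈ Icc 0 b)
    {X f : ℝ → Fin n → ℝ}
    (hX : ∀ i, IsPrimitive c (fun t => X t i) (fun t => (A t *ᵥ X t + f t) i)) (i : Fin n) :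
    IsPrimitive c (fun t => (Ψ t *ᵥ X t) i) (fun t => (Ψ t *ᵥ f t) i) := by
  refine (IsPrimitive.sum Finset.univ fun j _ =>
    ((h.isPrimitive_inv i j).mono hc).mul (hX j) hc.1).congr_deriv hc.1 fun t _ => ?_
  have : ∑ j, (-(Ψ t * A t) i j * X t j + Ψ t i j * (A t *ᵥ X t + f t) j)
      = ((-(Ψ t * A t)) *ᵥ X t + Ψ t *ᵥ (A t *ᵥ X t + f t)) i := by
    rw [Finset.sum_add_distrib]
    rfl
  rw [this]
  simp [neg_mulVec, mulVec_add]

/-- The forcing `f` is merely integrable, so the solution is written down by variation of constants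
as `Φ (ξ + ∫ Ψ f)` instead of being obtained by Picard iteration. -/
lemma exists_solution (h : IsFundamentalPair b A Φ Ψ) {c : ℝ} (hc : c ∈ Icc 0 b)
    {f : ℝ → Fin n → ℝ} (hf : ∀ i, IntervalIntegrable (fun t => f t i) volume 0 c)
    (ξ : Fin n → ℝ) : ∃ X : ℝ → Fin n → ℝ, X 0 = ξ ∧
      ∀ i, IsPrimitive c (fun t => X t i) (fun t => (A t *ᵥ X t + f t) i) := by
  have hΨf : ∀ i, IntervalIntegrable (fun t => (Ψ t *ᵥ f t) i) volume 0 c := fun i =>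
    intervalIntegrable_mulVec_apply hf h.continuous_inv i
  set Z : ℝ → Fin n → ℝ := fun t j => ξ j + ∫ s in (0 : ℝ)..t, (Ψ s *ᵥ f s) j with hZ
  have hZp : ∀ j, IsPrimitive c (fun t => Z t j) (fun t => (Ψ t *ᵥ f t) j) := fun j =>
    IsPrimitive.of_integral (hΨf j) (ξ j)
  refine ⟨fun t => Φ t *ᵥ Z t, ?_, fun i => ?_⟩
  · have : Z 0 = ξ := by ext j; simp [hZ]
    simp [h.zero, this]
  · refine (IsPrimitive.sum Finset.univ fun j _ =>
      ((h.isPrimitive i j).mono hc).mul (hZp j) hc.1).congr_deriv hc.1 fun t ht => ?_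
    have : ∑ j, ((A t * Φ t) i j * Z t j + Φ t i j * (Ψ t *ᵥ f t) j)
        = ((A t * Φ t) *ᵥ Z t + Φ t *ᵥ (Ψ t *ᵥ f t)) i := by
      rw [Finset.sum_add_distrib]
      rfl
    rw [this, mulVec_mulVec, h.mul_inv t ⟨ht.1.le, ht.2.trans hc.2⟩, one_mulVec, ← mulVec_mulVec]

lemma eq_mulVec (h : IsFundamentalPair b A Φ Ψ) {c : ℝ} (hc : c ∈ Icc 0 b) {X f : ℝ → Fin n → ℝ}
    (hX : ∀ i, IsPrimitive c (fun t => X t i) (fun t => (A t *ᵥ X t + f t) i)) {t : ℝ}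
    (ht : t ∈ Icc 0 c) :
    X t = Φ t *ᵥ fun i => X 0 i + ∫ s in (0 : ℝ)..t, (Ψ s *ᵥ f s) i := by
  have : (fun i => X 0 i + ∫ s in (0 : ℝ)..t, (Ψ s *ᵥ f s) i) = Ψ t *ᵥ X t := by
    ext i
    have := (h.isPrimitive_inv_mulVec hc hX i).2 t ht
    simp only [h.zero_inv, one_mulVec] at this
    exact this.symm
  rw [this, mulVec_mulVec, h.mul_inv t ⟨ht.1, ht.2.trans hc.2⟩, one_mulVec]

end IsFundamentalPair

end ImpulsiveDelay

/-! ### Existence of trajectories by the method of steps. -/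

namespace ImpulsiveDelay

variable {n pc pd qc qd : ℕ}

lemma impulseTime_zero (T : ℕ → ℝ) : impulseTime T 0 = 0 := by simp [impulseTime]

lemma impulseTime_succ (T : ℕ → ℝ) (k : ℕ) : impulseTime T (k + 1) = impulseTime T k + T k :=
  Finset.sum_range_succ _ _

lemma impulseTime_mono {T : ℕ → ℝ} (hT : ∀ k, 0 < T k) : Monotone (impulseTime T) :=
  monotone_nat_of_le_succ fun k => by rw [impulseTime_succ]; linarith [hT k]

lemma impulseTime_nonneg {T : ℕ → ℝ} (hT : ∀ k, 0 < T k) (k : ℕ) : 0 ≤ impulseTime T k :=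
  Finset.sum_nonneg fun i _ => (hT i).le

lemma IsDwellSeq.exists_mem_Ioc {T : ℕ → ℝ} (hT : IsDwellSeq T) {t : ℝ} (ht : 0 < t) :
    ∃ k, t - impulseTime T k ∈ Ioc 0 (T k) := by
  classical
  have hex : ∃ k, t ≤ impulseTime T k := (hT.2.eventually_ge_atTop t).exists
  have hne : Nat.find hex ≠ 0 := fun h0 => by
    have := Nat.find_spec hex
    rw [h0, impulseTime_zero] at this
    linarith
  obtain ⟨k, hk⟩ := Nat.exists_eq_succ_of_ne_zero hne
  refine ⟨k, sub_pos.2 (not_le.1 (Nat.find_min hex (hk ▸ Nat.lt_succ_self k))), ?_⟩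
  have := Nat.find_spec hex
  rw [hk, Nat.succ_eq_add_one, impulseTime_succ] at this
  linarith

lemma delayedSample_congr {hd : ℕ} {T : ℕ → ℝ} (hT : ∀ k, 0 < T k) (ψ : Fin hd → Fin n → ℝ)
    {x y : ℝ → Fin n → ℝ} {k : ℕ} (hxy : ∀ t ≤ impulseTime T k, x t = y t) :
    delayedSample hd T ψ x k = delayedSample hd T ψ y k := by
  unfold delayedSample
  split_ifs with h
  · exact hxy _ (impulseTime_mono hT (Nat.sub_le _ _))
  · rfl

lemma Sys.afterJump_congr (S : Sys n pc pd qc qd) {hd : ℕ} {T : ℕ → ℝ} (hT : ∀ k, 0 < T k)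
    (ψ : Fin hd → Fin n → ℝ) (wd : ℕ → Fin pd → ℝ) {x y : ℝ → Fin n → ℝ} {k : ℕ}
    (hxy : ∀ t ≤ impulseTime T k, x t = y t) :
    S.afterJump hd T ψ wd x k = S.afterJump hd T ψ wd y k := by
  unfold Sys.afterJump
  rw [delayedSample_congr hT ψ hxy, hxy _ le_rfl, hxy 0 (impulseTime_nonneg hT k)]

lemma Sys.flow_congr (S : Sys n pc pd qc qd) {hc : ℝ} (hhc : 0 ≤ hc) (T : ℕ → ℝ)
    (wc : ℝ → Fin pc → ℝ) {x y : ℝ → Fin n → ℝ} {k : ℕ}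
    (hxy : ∀ t ≤ impulseTime T (k + 1), x t = y t) {τ : ℝ} (hτ : τ ≤ T k) :
    S.flow hc T wc x k τ = S.flow hc T wc y k τ := by
  rw [impulseTime_succ] at hxy
  unfold Sys.flow
  rw [hxy _ (by linarith), hxy _ (by linarith)]

/-- `x` satisfies the defining properties of a trajectory up to the impulse time `t_k`. -/
structure Sys.IsTrajectoryUpTo (S : Sys n pc pd qc qd) (hc : ℝ) (hd : ℕ) (T : ℕ → ℝ)
    (φ : C(Icc (-hc) 0, Fin n → ℝ)) (ψ : Fin hd → Fin n → ℝ)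
    (wc : ℝ → Fin pc → ℝ) (wd : ℕ → Fin pd → ℝ) (k : ℕ) (x : ℝ → Fin n → ℝ) : Prop where
  init : ∀ s : Icc (-hc) 0, x s = φ s
  -- Carried along the construction so that the delayed term on the next interval is integrable.
  intervalIntegrable : ∀ i, IntervalIntegrable (fun t => x t i) volume (-hc) (impulseTime T k)
  integrable : ∀ j < k, IntervalIntegrable (S.flow hc T wc x j) volume 0 (T j)
  eq : ∀ j < k, ∀ τ ∈ Ioc 0 (T j), x (impulseTime T j + τ) =
    S.afterJump hd T ψ wd x j + ∫ s in (0 : ℝ)..τ, S.flow hc T wc x j s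

variable {S : Sys n pc pd qc qd} {hc : ℝ} {hd : ℕ} {T : ℕ → ℝ} {φ : C(Icc (-hc) 0, Fin n → ℝ)}
  {ψ : Fin hd → Fin n → ℝ} {wc : ℝ → Fin pc → ℝ} {wd : ℕ → Fin pd → ℝ}

/-- Freezing a coefficient at its value at 0 for negative arguments makes it continuous on all of ℝ,
as the results on fundamental matrices require. -/
lemma continuous_comp_max {m : ℕ} {M : ℝ → Matrix (Fin m) (Fin n) ℝ}
    (hM : ContinuousOn M (Ici 0)) : Continuous fun t => M (max 0 t) :=
  hM.comp_continuous (by fun_prop) fun t => mem_Ici.2 (le_max_left 0 t)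

lemma intervalIntegrable_shift {f : ℝ → ℝ} (t a b : ℝ)
    (hf : IntervalIntegrable f volume (t + a) (t + b)) :
    IntervalIntegrable (fun s => f (t + s)) volume a b := by
  simpa using hf.comp_add_left t

lemma intervalIntegrable_input {w : ℝ → Fin pc → ℝ} (hw : IntegrableOn w (Ioi 0)) {t b : ℝ}
    (ht : 0 ≤ t) (hb : 0 ≤ b) (i : Fin pc) :
    IntervalIntegrable (fun s => w (t + s) i) volume 0 b := by
  refine intervalIntegrable_shift (f := fun s => w s i) t 0 b ?_
  rw [intervalIntegrable_iff_integrableOn_Ioc_of_le (by linarith)]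
  exact IntegrableOn.mono_set (Integrable.eval hw i)
    fun s hs => lt_of_le_of_lt (by linarith) hs.1

/-- Since `T k ≤ hc`, the delayed argument `t_k + τ - hc` does not exceed `t_k`. On the next
interval the delayed term is therefore known, and the system is a linear equation without delay,
with integrable forcing. -/
lemma Sys.IsTrajectoryUpTo.exists_extension (hA : ContinuousOn S.A (Ici 0))
    (hG : ContinuousOn S.Gc (Ici 0)) (hE : ContinuousOn S.Ec (Ici 0)) (hhc : 0 < hc)
    (hT : ∀ k, 0 < T k) (hThc : ∀ k, T k ≤ hc) (hwc : IntegrableOn wc (Ioi 0)) {k : ℕ}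
    {x : ℝ → Fin n → ℝ} (hx : S.IsTrajectoryUpTo hc hd T φ ψ wc wd k x) :
    ∃ y, S.IsTrajectoryUpTo hc hd T φ ψ wc wd (k + 1) y ∧ ∀ t ≤ impulseTime T k, y t = x t := by
  have htk := impulseTime_nonneg hT k
  obtain ⟨Φ, Ψ, h⟩ := exists_isFundamentalPair (continuous_comp_max hA) hhc.le
  have hTk : T k ∈ Icc 0 hc := ⟨(hT k).le, hThc k⟩
  set f : ℝ → Fin n → ℝ := fun τ => S.Gc (max 0 τ) *ᵥ x (impulseTime T k - hc + τ)
    + S.Ec (max 0 τ) *ᵥ wc (impulseTime T k + τ) with hf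
  have hxint : ∀ i,
      IntervalIntegrable (fun τ => x (impulseTime T k - hc + τ) i) volume 0 (T k) := by
    intro i
    refine intervalIntegrable_shift (f := fun s => x s i) _ 0 (T k)
      ((hx.intervalIntegrable i).mono_set ?_)
    rw [uIcc_of_le (by linarith [hT k]), uIcc_of_le (by linarith)]
    exact Icc_subset_Icc (by linarith) (by linarith [hThc k])
  have hfint : ∀ i, IntervalIntegrable (fun τ => f τ i) volume 0 (T k) := fun i =>
    (intervalIntegrable_mulVec_apply hxint (continuous_comp_max hG) i).add
      (intervalIntegrable_mulVec_apply (intervalIntegrable_input hwc htk (hT k).le)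
        (continuous_comp_max hE) i)
  obtain ⟨X, hX0, hX⟩ := h.exists_solution hTk hfint (S.afterJump hd T ψ wd x k)
  -- Left-continuity: at `t_k` itself the value before the jump is kept, while `X 0` is the right
  -- limit.
  set y : ℝ → Fin n → ℝ := fun t => if t ≤ impulseTime T k then x t else X (t - impulseTime T k)
    with hy
  have hyx : ∀ t ≤ impulseTime T k, y t = x t := fun t ht => if_pos ht
  have hyX : ∀ τ, 0 < τ → y (impulseTime T k + τ) = X τ := fun τ hτ => by
    simp only [hy]
    rw [if_neg (by linarith), add_sub_cancel_left]
  have hle : ∀ j < k, impulseTime T (j + 1) ≤ impulseTime T k := fun j hj => impulseTime_mono hT hj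
  have hflow : ∀ τ ∈ Ioc 0 (T k), S.flow hc T wc y k τ = S.A (max 0 τ) *ᵥ X τ + f τ := by
    intro τ hτ
    simp only [Sys.flow, hf, max_eq_right hτ.1.le]
    rw [hyX τ hτ.1, hyx _ (by linarith [hτ.2, hThc k]), add_assoc,
      show impulseTime T k + τ - hc = impulseTime T k - hc + τ by ring]
  have hflowint : IntervalIntegrable (S.flow hc T wc y k) volume 0 (T k) := by
    refine (intervalIntegrable_of_apply fun i => (hX i).1).congr fun τ hτ => ?_
    rw [uIoc_of_le (hT k).le] at hτ
    exact (hflow τ hτ).symm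
  refine ⟨y, ⟨fun s => ?_, fun i => ?_, fun j hj => ?_, fun j hj τ hτ => ?_⟩, hyx⟩
  · rw [hyx _ (s.2.2.trans htk), hx.init]
  · refine IntervalIntegrable.trans (b := impulseTime T k) ((hx.intervalIntegrable i).congr ?_) ?_
    · intro t ht
      rw [uIoc_of_le (by linarith)] at ht
      simp only [hyx t ht.2]
    · have h1 : IntervalIntegrable (fun τ => X τ i) volume 0 (T k) := by
        have := (hX i).continuousOn (hT k).le
        rw [← uIcc_of_le (hT k).le] at this
        exact this.intervalIntegrable
      have h2 := h1.comp_sub_right (impulseTime T k)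
      rw [zero_add, add_comm (T k), ← impulseTime_succ] at h2
      refine h2.congr fun t ht => ?_
      rw [uIoc_of_le (impulseTime_mono hT k.le_succ)] at ht
      simp only [hy]
      rw [if_neg (not_le.2 ht.1)]
  · rcases Nat.lt_succ_iff_lt_or_eq.1 hj with hj | rfl
    · refine (hx.integrable j hj).congr fun τ hτ => ?_
      rw [uIoc_of_le (hT j).le] at hτ
      exact S.flow_congr hhc.le T wc (fun t ht => (hyx t (ht.trans (hle j hj))).symm) hτ.2
    · exact hflowint
  · rcases Nat.lt_succ_iff_lt_or_eq.1 hj with hj | rfl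
    · have hjk := hle j hj
      have hjτ : impulseTime T j + τ ≤ impulseTime T (j + 1) := by
        rw [impulseTime_succ]
        linarith [hτ.2]
      rw [hyx _ (hjτ.trans hjk),
        hx.eq j hj τ hτ]
      congr 1
      · exact S.afterJump_congr hT ψ wd fun t ht =>
          (hyx t (ht.trans (impulseTime_mono hT hj.le))).symm
      · refine intervalIntegral.integral_congr fun s hs => ?_
        rw [uIcc_of_le hτ.1.le] at hs
        exact S.flow_congr hhc.le T wc (fun t ht => (hyx t (ht.trans hjk)).symm) (hs.2.trans hτ.2)
    · have hτ' : τ ∈ Icc 0 (T j) := ⟨hτ.1.le, hτ.2⟩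
      ext i
      have hXi := (hX i).2 τ hτ'
      simp only [hX0] at hXi
      rw [hyX τ hτ.1, S.afterJump_congr hT ψ wd hyx, Pi.add_apply, intervalIntegral_apply
        (hflowint.mono_set (by rw [uIcc_of_le (hT j).le, uIcc_of_le hτ.1.le];
                               exact Icc_subset_Icc_right hτ.2)), hXi]
      congr 1
      refine intervalIntegral.integral_congr_ae (ae_of_all _ fun s hs => ?_)
      rw [uIoc_of_le hτ.1.le] at hs
      rw [hflow s ⟨hs.1, hs.2.trans hτ.2⟩]

/-- Existence of trajectories when the dwell-times do not exceed the continuous-time delay. -/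
theorem Sys.exists_isTrajectory (S : Sys n pc pd qc qd) (hA : ContinuousOn S.A (Ici 0))
    (hG : ContinuousOn S.Gc (Ici 0)) (hE : ContinuousOn S.Ec (Ici 0)) (hhc : 0 < hc)
    (hT : IsDwellSeq T) (hThc : ∀ k, T k ≤ hc)
    (φ : C(Icc (-hc) 0, Fin n → ℝ)) (ψ : Fin hd → Fin n → ℝ) (hwc : IntegrableOn wc (Ioi 0))
    (wd : ℕ → Fin pd → ℝ) : ∃ x, S.IsTrajectory hc hd T φ ψ wc wd x := by
  have h0 : S.IsTrajectoryUpTo hc hd T φ ψ wc wd 0 (IccExtend (neg_nonpos.2 hhc.le) φ) := by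
    refine ⟨fun s => IccExtend_val _ _ s, fun i => ?_, fun j hj => absurd hj j.not_lt_zero,
      fun j hj => absurd hj j.not_lt_zero⟩
    exact ((continuous_apply i).comp φ.continuous.Icc_extend').intervalIntegrable _ _
  choose! next hnext hnexteq using fun (k : ℕ) (x : ℝ → Fin n → ℝ)
    (hx : S.IsTrajectoryUpTo hc hd T φ ψ wc wd k x) =>
      hx.exists_extension hA hG hE hhc hT.1 hThc hwc
  let X : ℕ → ℝ → Fin n → ℝ := fun k => Nat.rec (IccExtend (neg_nonpos.2 hhc.le) φ) next k
  have hX : ∀ k, S.IsTrajectoryUpTo hc hd T φ ψ wc wd k (X k) := fun k => by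
    induction k with
    | zero => exact h0
    | succ k ih => exact hnext k _ ih
  have hXX : ∀ k m, k ≤ m → ∀ t ≤ impulseTime T k, X m t = X k t := fun k m hkm => by
    induction m, hkm using Nat.le_induction with
    | base => exact fun _ _ => rfl
    | succ m hkm ih =>
      exact fun t ht =>
        (hnexteq m _ (hX m) t (ht.trans (impulseTime_mono hT.1 hkm))).trans (ih t ht)
  -- The value at `t` is read off some stage that has reached `t`; the stages agree, so the choice
  -- does not matter.
  choose K hK using fun t : ℝ => (hT.2.eventually_ge_atTop t).exists
  have hx : ∀ k, ∀ t ≤ impulseTime T k, X (K t) t = X k t := fun k t ht => by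
    rcases le_total k (K t) with h | h
    · exact hXX _ _ h t ht
    · exact (hXX _ _ h t (hK t)).symm
  refine ⟨fun t => X (K t) t, fun s => ?_, fun k => ?_, fun k τ hτ => ?_⟩
  · rw [hx 0 s (by rw [impulseTime_zero]; exact s.2.2)]
    exact h0.init s
  · refine ((hX (k + 1)).integrable k k.lt_succ_self).congr fun τ hτ => ?_
    rw [uIoc_of_le (hT.1 k).le] at hτ
    exact S.flow_congr hhc.le T wc (fun t ht => (hx _ t ht).symm) hτ.2
  · rw [hx (k + 1) _ (by rw [impulseTime_succ]; linarith [hτ.2]),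
      (hX (k + 1)).eq k k.lt_succ_self τ hτ]
    congr 1
    · exact S.afterJump_congr hT.1 ψ wd fun t ht =>
        (hx _ t (ht.trans (impulseTime_mono hT.1 k.le_succ))).symm
    · refine intervalIntegral.integral_congr fun s hs => ?_
      rw [uIcc_of_le hτ.1.le] at hs
      exact S.flow_congr hhc.le T wc (fun t ht => (hx _ t ht).symm) (hs.2.trans hτ.2)

end ImpulsiveDelay

/-! ### Arcs between impulses and test trajectories. -/

namespace ImpulsiveDelay

variable {n pc pd qc qd : ℕ}

/-- The continuous extension to `[0, T_k]` of the trajectory on `(t_k, t_{k+1}]`. -/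
noncomputable def Sys.arc (S : Sys n pc pd qc qd) (hc : ℝ) (hd : ℕ) (T : ℕ → ℝ)
    (ψ : Fin hd → Fin n → ℝ) (wc : ℝ → Fin pc → ℝ) (wd : ℕ → Fin pd → ℝ) (x : ℝ → Fin n → ℝ)
    (k : ℕ) (τ : ℝ) : Fin n → ℝ :=
  S.afterJump hd T ψ wd x k + ∫ s in (0 : ℝ)..τ, S.flow hc T wc x k s

variable {S : Sys n pc pd qc qd} {hc : ℝ} {hd : ℕ} {T : ℕ → ℝ} {φ : C(Icc (-hc) 0, Fin n → ℝ)}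
  {ψ : Fin hd → Fin n → ℝ} {wc : ℝ → Fin pc → ℝ} {wd : ℕ → Fin pd → ℝ} {x : ℝ → Fin n → ℝ}

lemma Sys.arc_zero (S : Sys n pc pd qc qd) (hc : ℝ) (hd : ℕ) (T : ℕ → ℝ)
    (ψ : Fin hd → Fin n → ℝ) (wc : ℝ → Fin pc → ℝ) (wd : ℕ → Fin pd → ℝ) (x : ℝ → Fin n → ℝ)
    (k : ℕ) : S.arc hc hd T ψ wc wd x k 0 = S.afterJump hd T ψ wd x k := by
  simp [Sys.arc]

namespace Sys.IsTrajectory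

lemma eq_arc (h : S.IsTrajectory hc hd T φ ψ wc wd x) {k : ℕ} {τ : ℝ} (hτ : τ ∈ Ioc 0 (T k)) :
    x (impulseTime T k + τ) = S.arc hc hd T ψ wc wd x k τ :=
  h.eq k τ hτ

lemma isPrimitive_flow (h : S.IsTrajectory hc hd T φ ψ wc wd x) (hT : ∀ k, 0 < T k) (k : ℕ)
    (i : Fin n) : IsPrimitive (T k) (fun τ => S.arc hc hd T ψ wc wd x k τ i)
      (fun τ => S.flow hc T wc x k τ i) := by
  refine (IsPrimitive.of_integral (intervalIntegrable_apply (h.integrable k) i)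
    (S.afterJump hd T ψ wd x k i)).congr (hT k).le fun t ht => ?_
  rw [Sys.arc, Pi.add_apply, intervalIntegral_apply]
  refine (h.integrable k).mono_set ?_
  rw [uIcc_of_le (hT k).le, uIcc_of_le ht.1]
  exact Icc_subset_Icc_right ht.2

lemma continuousOn_arc (h : S.IsTrajectory hc hd T φ ψ wc wd x) (hT : ∀ k, 0 < T k) (k : ℕ) :
    ContinuousOn (S.arc hc hd T ψ wc wd x k) (Icc 0 (T k)) :=
  continuousOn_pi.2 fun i => (h.isPrimitive_flow hT k i).continuousOn (hT k).le

lemma isPrimitive_arc (h : S.IsTrajectory hc hd T φ ψ wc wd x) (hT : ∀ k, 0 < T k) (k : ℕ)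
    (i : Fin n) : IsPrimitive (T k) (fun τ => S.arc hc hd T ψ wc wd x k τ i)
      (fun τ => (S.A (max 0 τ) *ᵥ S.arc hc hd T ψ wc wd x k τ +
        (S.Gc (max 0 τ) *ᵥ x (impulseTime T k + τ - hc) +
          S.Ec (max 0 τ) *ᵥ wc (impulseTime T k + τ))) i) := by
  refine (h.isPrimitive_flow hT k i).congr_deriv (hT k).le fun τ hτ => ?_
  rw [Sys.flow, h.eq_arc hτ, max_eq_right hτ.1.le, add_assoc]

lemma arc_eq_mulVec (h : S.IsTrajectory hc hd T φ ψ wc wd x) (hT : ∀ k, 0 < T k) {b : ℝ}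
    {Φ Ψ : ℝ → Matrix (Fin n) (Fin n) ℝ}
    (hΦ : IsFundamentalPair b (fun t => S.A (max 0 t)) Φ Ψ) {k : ℕ} (hb : T k ≤ b) {τ : ℝ}
    (hτ : τ ∈ Icc 0 (T k)) :
    S.arc hc hd T ψ wc wd x k τ = Φ τ *ᵥ fun i => S.afterJump hd T ψ wd x k i +
      ∫ s in (0 : ℝ)..τ, (Ψ s *ᵥ (S.Gc (max 0 s) *ᵥ x (impulseTime T k + s - hc) +
          S.Ec (max 0 s) *ᵥ wc (impulseTime T k + s))) i := by
  rw [hΦ.eq_mulVec ⟨(hT k).le, hb⟩ (fun i => h.isPrimitive_arc hT k i) hτ, S.arc_zero]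

end Sys.IsTrajectory

lemma nonneg_of_continuousOn {g : ℝ → ℝ} {b : ℝ} (hb : 0 < b) (hg : ContinuousOn g (Icc 0 b))
    (h : ∀ τ ∈ Ioc 0 b, 0 ≤ g τ) : 0 ≤ g 0 := by
  have h1 : Tendsto g (𝓝[Ioc 0 b] 0) (𝓝 (g 0)) :=
    ((hg 0 ⟨le_rfl, hb.le⟩).mono Ioc_subset_Icc_self).tendsto
  have : (𝓝[Ioc 0 b] (0 : ℝ)).NeBot := left_nhdsWithin_Ioc_neBot hb
  exact ge_of_tendsto h1 (eventually_mem_nhdsWithin.mono h)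

/-- The vector after the jump need not be a value of `x`, but it is the limit of `x (t_k + τ)` as
`τ` decreases to 0. -/
lemma Sys.IsTrajectory.afterJump_nonneg (h : S.IsTrajectory hc hd T φ ψ wc wd x)
    (hT : ∀ k, 0 < T k) (hx : ∀ t, 0 ≤ t → 0 ≤ x t) (k : ℕ) :
    0 ≤ S.afterJump hd T ψ wd x k := fun i => by
  rw [← S.arc_zero hc hd T ψ wc wd x k]
  refine nonneg_of_continuousOn (hT k) ((h.isPrimitive_flow hT k i).continuousOn (hT k).le)
    fun τ hτ => ?_
  rw [← h.eq_arc hτ]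
  exact hx _ (add_nonneg (impulseTime_nonneg hT k) hτ.1.le) i

lemma isDwellSeq_const {c : ℝ} (hc : 0 < c) : IsDwellSeq fun _ => c := by
  refine ⟨fun _ => hc, ?_⟩
  have : impulseTime (fun _ => c) = fun k : ℕ => (k : ℝ) * c := by
    ext k
    simp [impulseTime]
  rw [this]
  exact tendsto_natCast_atTop_atTop.atTop_mul_const hc

/-- Test trajectories for the consequences of internal positivity. -/
lemma Sys.InternallyPositive.exists_trajectory_const (hpos : S.InternallyPositive)
    (hA : ContinuousOn S.A (Ici 0)) (hG : ContinuousOn S.Gc (Ici 0))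
    (hE : ContinuousOn S.Ec (Ici 0)) {b c : ℝ} (hc : 0 < c) (hcb : c ≤ b) (hd : ℕ)
    {φ : ℝ → Fin n → ℝ} (hφ : Continuous φ) (hφ0 : ∀ s ∈ Icc (-b) 0, 0 ≤ φ s)
    {ψ : Fin n → ℝ} (hψ0 : 0 ≤ ψ) {Φ Ψ : ℝ → Matrix (Fin n) (Fin n) ℝ}
    (hΦ : IsFundamentalPair b (fun t => S.A (max 0 t)) Φ Ψ) :
    ∃ x : ℝ → Fin n → ℝ, ContinuousOn x (Icc 0 c) ∧ (∀ t, 0 ≤ t → 0 ≤ x t) ∧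
      (∀ s ∈ Icc (-b) 0, x s = φ s) ∧
      (∀ t, 0 < t → 0 ≤ S.zc b 0 x t) ∧ 0 ≤ S.zd hd (fun _ => c) (fun _ => ψ) 0 x 1 ∧
      0 ≤ S.afterJump hd (fun _ => c) (fun _ => ψ) 0 x 1 ∧
      ∀ τ ∈ Icc 0 c, x τ = Φ τ *ᵥ fun i => φ 0 i +
        ∫ s in (0 : ℝ)..τ, (Ψ s *ᵥ (S.Gc s *ᵥ φ (s - b))) i := by
  have hT := isDwellSeq_const hc
  have hb0 : 0 < b := hc.trans_le hcb
  obtain ⟨x, hx⟩ := S.exists_isTrajectory hA hG hE hb0 hT (fun _ => hcb)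
    ⟨fun s => φ s, by fun_prop⟩ (fun _ : Fin hd => ψ) (wc := 0) (integrable_zero _ _ _) 0
  obtain ⟨h1, h2, h3⟩ := hpos b hd _ hb0 hT _ _ _ _ x
    (IntegrableOn.locallyIntegrableOn (integrable_zero _ _ _)) hx
    (fun s => hφ0 s s.2) (fun _ => hψ0) (fun _ _ => le_rfl) (fun _ _ => le_rfl)
  have hxφ : ∀ s ∈ Icc (-b) 0, x s = φ s := fun s hs => hx.init ⟨s, hs⟩
  have h0 : x 0 = φ 0 := hxφ 0 ⟨by linarith, le_rfl⟩
  have hx0 : S.afterJump hd (fun _ => c) (fun _ => ψ) 0 x 0 = φ 0 := by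
    simp [Sys.afterJump, h0]
  have harc : ∀ τ ∈ Icc 0 c, x τ = S.arc b hd (fun _ => c) (fun _ => ψ) 0 0 x 0 τ := fun τ hτ => by
    rcases hτ.1.eq_or_lt with h | h
    · rw [← h, S.arc_zero, hx0, h0]
    · rw [← hx.eq_arc ⟨h, hτ.2⟩, impulseTime_zero, zero_add]
  refine ⟨x, (hx.continuousOn_arc hT.1 0).congr harc, h1, hxφ, h2, h3 1 le_rfl,
    hx.afterJump_nonneg hT.1 h1 1, fun τ hτ => ?_⟩
  rw [harc τ hτ, hx.arc_eq_mulVec hT.1 hΦ hcb hτ, hx0]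
  congr 1
  ext i
  congr 1
  -- As `c ≤ b`, the delayed argument stays in `[-b, 0]`, where `x` is the prescribed `φ`.
  refine intervalIntegral.integral_congr fun s hs => ?_
  rw [uIcc_of_le hτ.1] at hs
  simp only [impulseTime_zero, zero_add, Pi.zero_apply, mulVec_zero, add_zero, max_eq_right hs.1]
  rw [hxφ _ ⟨by linarith [hs.1], by linarith [hs.2, hτ.2]⟩]

end ImpulsiveDelay

/-! ### Sign conditions forced by internal positivity. -/

namespace ImpulsiveDelay

variable {n pc pd qc qd : ℕ} {S : Sys n pc pd qc qd} {Φ Ψ : ℝ → Matrix (Fin n) (Fin n) ℝ} {a : ℝ}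

/-- The test function `g` lives where `k < 0`, so `k g ≤ 0`, and a negative value of `k` would make
the integral negative. The factor `b - s` is positive on `[0, τ]` and makes `g b = 0`, which
`kernel_nonneg` uses to start at the state 0. -/
lemma nonneg_of_integral_mul_nonneg {k g : ℝ → ℝ} {τ b : ℝ} (hk : Continuous k)
    (hτ : 0 < τ) (hτb : τ < b) (hg : ∀ s, g s = max (-k s) 0 * (b - s))
    (h : 0 ≤ ∫ s in (0 : ℝ)..τ, k s * g s) {s : ℝ} (hs : s ∈ Icc 0 τ) : 0 ≤ k s := by
  by_contra hneg
  have hle : ∀ r ∈ Icc 0 τ, 0 ≤ -(k r * g r) := fun r hr => by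
    rw [hg]
    rcases le_total 0 (k r) with h0 | h0
    · simp [max_eq_right (neg_nonpos.2 h0)]
    · rw [max_eq_left (neg_nonneg.2 h0)]
      have : 0 ≤ b - r := by linarith [hr.2]
      nlinarith [mul_nonneg (mul_self_nonneg (k r)) this]
  have hpos : 0 < ∫ r in (0 : ℝ)..τ, -(k r * g r) := by
    refine intervalIntegral.integral_pos hτ ?_ (fun r hr => hle r ⟨hr.1.le, hr.2⟩) ⟨s, hs, ?_⟩
    · simp only [hg]
      fun_prop
    · rw [hg, max_eq_left (by linarith)]
      have h1 : 0 < b - s := by linarith [hs.2]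
      have h2 : 0 < k s * k s := mul_pos_of_neg_of_neg (not_le.1 hneg) (not_le.1 hneg)
      nlinarith [mul_pos h2 h1]
  rw [intervalIntegral.integral_neg] at hpos
  linarith

namespace Sys.InternallyPositive

/-- With delay `b` and initial function `g (r + b)` in the direction `j`, the initial state is `g b
= 0` and the delayed state at time `s` is `g s`. Component `i` of the state at `τ` is then `∫ k g`,
which is nonnegative for every nonnegative continuous `g` with `g b = 0`; the negative part of `k`
is used to build `g`. -/
lemma kernel_nonneg (hpos : S.InternallyPositive) (hA : ContinuousOn S.A (Ici 0))
    (hG : ContinuousOn S.Gc (Ici 0)) (hE : ContinuousOn S.Ec (Ici 0)) (ha : 0 ≤ a)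
    (hΦ : IsFundamentalPair (a + 1) (fun t => S.A (max 0 t)) Φ Ψ) {τ : ℝ} (hτ : τ ∈ Ioc 0 a)
    {s : ℝ} (hs : s ∈ Icc 0 τ) (i j : Fin n) : 0 ≤ (Φ τ * Ψ s * S.Gc s) i j := by
  set b := a + 1 with hb
  set k : ℝ → ℝ := fun s => (Φ τ * Ψ s * S.Gc (max 0 s)) i j with hk
  have hkc : Continuous k := ((continuous_const.matrix_mul hΦ.continuous_inv).matrix_mul
    (continuous_comp_max hG)).matrix_elem i j
  set g : ℝ → ℝ := fun s => max (-k s) 0 * (b - s) with hg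
  obtain ⟨x, -, hx, -, -, -, -, hxeq⟩ := hpos.exists_trajectory_const hA hG hE (b := b) (c := b)
    (by linarith) le_rfl 0 (φ := fun r => g (r + b) • Pi.single j 1)
    (by fun_prop) (fun r hr => smul_nonneg (mul_nonneg (le_max_right _ _) (by linarith [hr.2]))
      (Pi.single_nonneg.2 zero_le_one)) (ψ := 0) le_rfl hΦ
  have h1 : 0 ≤ ∫ s in (0 : ℝ)..τ, k s * g s := by
    set F : ℝ → Fin n → ℝ := fun r => Ψ r *ᵥ (S.Gc r *ᵥ (g r • Pi.single j 1)) with hF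
    have h2 : 0 ≤ ∑ l, Φ τ i l * ∫ s in (0 : ℝ)..τ, F s l := by
      have h3 := hx τ hτ.1.le i
      have h4 : g b = 0 := by simp [hg]
      rw [hxeq τ ⟨hτ.1.le, by linarith [hτ.2]⟩] at h3
      simp only [h4, sub_add_cancel, zero_smul, Pi.zero_apply, zero_add] at h3
      exact h3
    have hFint : ∀ l, IntervalIntegrable (fun r => F r l) volume 0 τ := fun l => by
      have hcont : Continuous fun r => (Ψ r *ᵥ (S.Gc (max 0 r) *ᵥ (g r • Pi.single j 1))) l :=
        (continuous_apply l).comp (hΦ.continuous_inv.matrix_mulVec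
          ((continuous_comp_max hG).matrix_mulVec (by fun_prop)))
      refine (hcont.intervalIntegrable 0 τ).congr fun r hr => ?_
      rw [uIoc_of_le hτ.1.le] at hr
      simp only [max_eq_right hr.1.le, hF]
    have h5 : ∫ s in (0 : ℝ)..τ, k s * g s = ∫ s in (0 : ℝ)..τ, ∑ l, Φ τ i l * F s l := by
      refine intervalIntegral.integral_congr fun r hr => ?_
      rw [uIcc_of_le hτ.1.le] at hr
      have : ∑ l, Φ τ i l * F r l = (Φ τ *ᵥ (Ψ r *ᵥ (S.Gc r *ᵥ (g r • Pi.single j 1)))) i := rfl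
      simp only [hk, max_eq_right hr.1]
      rw [this, mulVec_mulVec, mulVec_mulVec, mulVec_smul, mulVec_single_one]
      simp only [Pi.smul_apply, col_apply, smul_eq_mul]
      ring
    rw [h5, intervalIntegral.integral_finsetSum fun l _ => (hFint l).const_mul _]
    simpa only [intervalIntegral.integral_const_mul] using h2
  have := nonneg_of_integral_mul_nonneg hkc hτ.1 (by linarith [hτ.2] : τ < b) (fun _ => rfl) h1 hs
  simpa only [hk, max_eq_right hs.1] using this

/-- Trajectories which start at a unit vector and whose delayed terms vanish initially. -/
lemma exists_trajectory_single (hpos : S.InternallyPositive) (hA : ContinuousOn S.A (Ici 0))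
    (hG : ContinuousOn S.Gc (Ici 0)) (hE : ContinuousOn S.Ec (Ici 0))
    (hΦ : IsFundamentalPair (a + 1) (fun t => S.A (max 0 t)) Φ Ψ) {c : ℝ} (hc : c ∈ Ioc 0 a)
    (j : Fin n) : ∃ x : ℝ → Fin n → ℝ, 0 ≤ x c ∧ x c = Φ c *ᵥ Pi.single j 1 ∧
      0 ≤ S.Cc *ᵥ x c ∧ 0 ≤ S.Cd *ᵥ x c + S.Hd *ᵥ x c ∧ 0 ≤ S.J *ᵥ x c + S.Gd *ᵥ x c := by
  have ha : 0 < a := hc.1.trans_le hc.2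
  -- The initial function vanishes on `r ≤ -1`, and the delay `a + 1` keeps the delayed argument
  -- there up to time `c ≤ a`. With `hd = 0` the delayed sample at the first impulse is `x c`
  -- itself.
  obtain ⟨x, -, hx, hxφ, hz, hzd, hj, hxeq⟩ := hpos.exists_trajectory_const hA hG hE (b := a + 1)
    (c := c) hc.1 (by linarith [hc.2]) 0
    (φ := fun r => max 0 (1 + r) • Pi.single j 1)
    (by fun_prop) (fun r hr => smul_nonneg (le_max_left _ _)
      (Pi.single_nonneg.2 zero_le_one)) (ψ := 0) le_rfl hΦ
  have h1 : x c = Φ c *ᵥ Pi.single j 1 := by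
    rw [hxeq c ⟨hc.1.le, le_rfl⟩]
    congr 1
    ext i
    rw [intervalIntegral.integral_congr (g := fun _ => 0)]
    · simp
    · intro s hs
      rw [uIcc_of_le hc.1.le] at hs
      have : max 0 (1 + (s - (a + 1))) = 0 := max_eq_left (by linarith [hs.2, hc.2])
      simp only [this, zero_smul, mulVec_zero, Pi.zero_apply]
  refine ⟨x, hx c hc.1.le, h1, ?_, ?_, ?_⟩
  · have := hz c hc.1
    rw [Sys.zc, hxφ (c - (a + 1)) ⟨by linarith [hc.1], by linarith [hc.2]⟩] at this
    have h0 : max 0 (1 + (c - (a + 1))) = 0 := max_eq_left (by linarith [hc.2])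
    simpa only [h0, zero_smul, mulVec_zero, Pi.zero_apply, add_zero] using this
  · simpa [Sys.zd, delayedSample, impulseTime] using hzd
  · simpa [Sys.afterJump, delayedSample, impulseTime] using hj

lemma fundamental_nonneg (hpos : S.InternallyPositive) (hA : ContinuousOn S.A (Ici 0))
    (hG : ContinuousOn S.Gc (Ici 0)) (hE : ContinuousOn S.Ec (Ici 0))
    (hΦ : IsFundamentalPair (a + 1) (fun t => S.A (max 0 t)) Φ Ψ) {c : ℝ} (hc : c ∈ Ioc 0 a)
    (i j : Fin n) : 0 ≤ Φ c i j := by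
  obtain ⟨x, hx, hxeq, -⟩ := hpos.exists_trajectory_single hA hG hE hΦ hc j
  have := hx i
  rw [hxeq] at this
  simpa using this

/-- The test trajectories give information at positive times only; as `c → 0`, `Φ c` tends to the
identity. -/
lemma entry_nonneg_of_mulVec {m : ℕ} (ha : 0 < a)
    (hΦ : IsFundamentalPair (a + 1) (fun t => S.A (max 0 t)) Φ Ψ) {M : Matrix (Fin m) (Fin n) ℝ}
    (h : ∀ j, ∀ c ∈ Ioc 0 a, 0 ≤ M *ᵥ (Φ c *ᵥ Pi.single j 1)) (i : Fin m) (j : Fin n) :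
    0 ≤ M i j := by
  have := nonneg_of_continuousOn (g := fun c => (M *ᵥ (Φ c *ᵥ Pi.single j 1)) i) ha
    ((continuous_apply i).comp (continuous_const.matrix_mulVec
      (hΦ.continuous.matrix_mulVec continuous_const))).continuousOn fun c hc => h j c hc i
  rw [hΦ.zero, one_mulVec, mulVec_single_one] at this
  exact this

/-- Sign conditions on the matrices of an internally positive system. -/
lemma entries_nonneg (hpos : S.InternallyPositive) (hA : ContinuousOn S.A (Ici 0))
    (hG : ContinuousOn S.Gc (Ici 0)) (hE : ContinuousOn S.Ec (Ici 0)) :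
    (∀ i j, 0 ≤ S.Cc i j) ∧ (∀ i j, 0 ≤ S.Hc i j) ∧ (∀ i j, 0 ≤ (S.J + S.Gd) i j) ∧
      (∀ i j, 0 ≤ (S.Cd + S.Hd) i j) ∧ (∀ i j, 0 ≤ S.Gd i j) ∧ ∀ i j, 0 ≤ S.Hd i j := by
  obtain ⟨Φ, Ψ, hΦ⟩ := exists_isFundamentalPair (b := 1 + 1) (continuous_comp_max hA) (by norm_num)
  have hs := fun c (hc : c ∈ Ioc (0 : ℝ) 1) j => hpos.exists_trajectory_single hA hG hE hΦ hc j
  have hψ : ∀ j : Fin n, (∀ i, 0 ≤ S.Gd i j) ∧ ∀ i, 0 ≤ S.Hd i j := fun j => by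
    -- With `hd = 2` the delayed sample at the first impulse is initial data (for `hd = 1` it would
    -- be `x 0`). As `φ = 0` gives `x 1 = 0`, only the `Gd` and `Hd` terms survive.
    obtain ⟨x, -, -, -, -, hzd, hj, hxeq⟩ := hpos.exists_trajectory_const hA hG hE (b := 1 + 1)
      (c := 1) one_pos (by norm_num) 2 (φ := fun _ => 0) continuous_const
      (fun _ _ => le_rfl) (ψ := Pi.single j 1) (Pi.single_nonneg.2 zero_le_one) hΦ
    have hx1 : x 1 = 0 := by
      rw [hxeq 1 ⟨zero_le_one, le_rfl⟩]
      ext i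
      simp [mulVec, dotProduct]
    refine ⟨fun i => ?_, fun i => ?_⟩
    · have := hj i
      simpa [Sys.afterJump, delayedSample, impulseTime, hx1] using this
    · have := hzd i
      simpa [Sys.zd, delayedSample, impulseTime, hx1] using this
  refine ⟨entry_nonneg_of_mulVec one_pos hΦ fun j c hc => ?_, fun i j => ?_,
    entry_nonneg_of_mulVec one_pos hΦ fun j c hc => ?_,
    entry_nonneg_of_mulVec one_pos hΦ fun j c hc => ?_, fun i j => (hψ j).1 i,
    fun i j => (hψ j).2 i⟩
  · obtain ⟨x, -, hxeq, h, -⟩ := hs c hc j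
    rwa [hxeq] at h
  -- The function `-r / 2` vanishes at 0 and equals 1 at minus the delay, so as `c → 0` the output
  -- tends to column `j` of `Hc`.
  · obtain ⟨x, hxc, hx, hxφ, hz, -, -, hxeq⟩ := hpos.exists_trajectory_const hA hG hE (b := 1 + 1)
      (c := 1) one_pos (by norm_num) 0 (φ := fun r => (-r / 2) • Pi.single j 1)
      (by fun_prop) (fun r hr => smul_nonneg (by linarith [hr.2])
        (Pi.single_nonneg.2 zero_le_one)) (ψ := 0) le_rfl hΦ
    have := nonneg_of_continuousOn
      (g := fun c => (S.Cc *ᵥ x c + S.Hc *ᵥ (-(c - (1 + 1)) / 2) • Pi.single j 1) i) one_pos ?_ ?_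
    · have hx0 : x 0 = 0 := by simp [hxφ 0 ⟨by norm_num, le_rfl⟩]
      simpa [hx0, mulVec_smul] using this
    · have h1 : ContinuousOn (fun c => S.Cc *ᵥ x c) (Icc 0 1) :=
        (continuous_const.matrix_mulVec continuous_id).comp_continuousOn hxc
      have h2 : Continuous fun c : ℝ => S.Hc *ᵥ ((-(c - (1 + 1)) / 2) • Pi.single j 1) :=
        continuous_const.matrix_mulVec (by fun_prop)
      exact (continuous_apply i).comp_continuousOn (h1.add h2.continuousOn)
    · intro c hc
      have := hz c hc.1 i
      rw [Sys.zc, hxφ (c - (1 + 1)) ⟨by linarith [hc.1], by linarith [hc.2]⟩] at this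
      simpa only [Pi.zero_apply, mulVec_zero, add_zero] using this
  · obtain ⟨x, -, hxeq, -, -, h⟩ := hs c hc j
    rw [add_mulVec, ← hxeq]
    exact h
  · obtain ⟨x, -, hxeq, -, h, -⟩ := hs c hc j
    rw [add_mulVec, ← hxeq]
    exact h

end Sys.InternallyPositive
end ImpulsiveDelay

/-! ### The certificate and the sign of the continuous-time delay weight. -/

namespace ImpulsiveDelay

variable {n pc pd qc qd : ℕ}

/-- The linear inequalities, in the unknown `ζ`, which certify stability and the gain bound. -/
structure Sys.IsCertificate (S : Sys n pc pd qc qd) (Tmin Tmax : ℝ) (ζ : ℝ → Fin n → ℝ)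
    (ε γ : ℝ) : Prop where
  differentiableOn : DifferentiableOn ℝ ζ (Icc 0 Tmax)
  zero_pos : ∀ i, 0 < ζ 0 i
  flow_state : ∀ τ ∈ Icc 0 Tmax,
    derivWithin ζ (Icc 0 Tmax) τ + ζ τ ᵥ* (S.A τ + S.Gc τ) + 1 ᵥ* (S.Cc + S.Hc) ≤ 0
  flow_input : ∀ τ ∈ Icc 0 Tmax, ζ τ ᵥ* S.Ec τ + 1 ᵥ* S.Fc ≤ fun _ => γ
  jump_state : ∀ θ ∈ Icc Tmin Tmax,
    -ζ θ + ζ 0 ᵥ* (S.J + S.Gd) + 1 ᵥ* (S.Cd + S.Hd) ≤ fun _ => -ε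
  jump_input : ζ 0 ᵥ* S.Ed + 1 ᵥ* S.Fd ≤ fun _ => γ

lemma vecMul_nonneg {l m : ℕ} {v : Fin l → ℝ} {M : Matrix (Fin l) (Fin m) ℝ} (hv : 0 ≤ v)
    (hM : ∀ i j, 0 ≤ M i j) : 0 ≤ v ᵥ* M := fun j =>
  dotProduct_nonneg_of_nonneg hv fun i => hM i j

/-- A backward Gronwall inequality. -/
lemma nonpos_of_le_integral {u : ℝ → ℝ} (hu : Continuous u) {a L : ℝ} (hL : 0 ≤ L)
    (h : ∀ s ∈ Icc 0 a, u s ≤ L * ∫ r in s..a, u r) {s : ℝ} (hs : s ∈ Icc 0 a) : u s ≤ 0 := by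
  set U : ℝ → ℝ := fun s => ∫ r in s..a, u r with hU
  have hUd : ∀ s, HasDerivAt U (-u s) s := fun s =>
    intervalIntegral.integral_hasDerivAt_left (hu.intervalIntegrable _ _)
      (hu.stronglyMeasurableAtFilter _ _) hu.continuousAt
  have hEd : ∀ s, HasDerivAt (fun s => Real.exp (L * s) * U s)
      (Real.exp (L * s) * (L * 1) * U s + Real.exp (L * s) * -u s) s := fun s =>
    (((hasDerivAt_id s).const_mul L).exp).mul (hUd s)
  have hmono : MonotoneOn (fun s => Real.exp (L * s) * U s) (Icc 0 a) := by
    refine monotoneOn_of_deriv_nonneg (convex_Icc 0 a)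
      (fun s _ => (hEd s).continuousAt.continuousWithinAt)
      (fun s _ => (hEd s).differentiableAt.differentiableWithinAt) fun s hs' => ?_
    rw [(hEd s).deriv]
    have := h s (interior_subset hs')
    have hexp := Real.exp_pos (L * s)
    have h2 : 0 ≤ Real.exp (L * s) * (L * U s - u s) :=
      mul_nonneg hexp.le (sub_nonneg.2 this)
    linarith
  have h1 := hmono hs ⟨hs.1.trans hs.2, le_rfl⟩ hs.2
  have hUa : U a = 0 := intervalIntegral.integral_same
  simp only [hUa, mul_zero] at h1
  have h2 : U s ≤ 0 := by
    by_contra h3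
    exact absurd h1 (not_le.2 (mul_pos (Real.exp_pos _) (not_le.1 h3)))
  exact (h s hs).trans (mul_nonpos_of_nonneg_of_nonpos hL h2)

namespace Sys.IsCertificate

variable {S : Sys n pc pd qc qd} {Tmin Tmax ε γ : ℝ} {ζ : ℝ → Fin n → ℝ}

lemma exists_continuous_extension (h : S.IsCertificate Tmin Tmax ζ ε γ) (hT : 0 ≤ Tmax) :
    ∃ ζ' : ℝ → Fin n → ℝ, Continuous ζ' ∧ ∀ t ∈ Icc 0 Tmax, ζ' t = ζ t :=
  ⟨IccExtend hT ((Icc 0 Tmax).domRestrict ζ),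
    (continuousOn_iff_continuous_domRestrict.1 h.differentiableOn.continuousOn).Icc_extend',
    fun _ ht => IccExtend_of_mem hT _ ht⟩

/-- Differentiability alone does not make the derivative of `ζ` integrable; the flow inequality
does, by bounding it above by a continuous function. -/
lemma isPrimitive (h : S.IsCertificate Tmin Tmax ζ ε γ) (hA : ContinuousOn S.A (Ici 0))
    (hG : ContinuousOn S.Gc (Ici 0)) (hT : 0 ≤ Tmax) (i : Fin n) :
    IsPrimitive Tmax (fun t => ζ t i) (fun t => derivWithin ζ (Icc 0 Tmax) t i) := by
  obtain ⟨ζ', hζ', hζζ'⟩ := h.exists_continuous_extension hT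
  refine IsPrimitive.of_hasDerivAt_le hT
    ((continuous_apply i).comp_continuousOn h.differentiableOn.continuousOn) (fun t ht => ?_)
    (g := fun t => -((ζ' t ᵥ* (S.A (max 0 t) + S.Gc (max 0 t)) + 1 ᵥ* (S.Cc + S.Hc)) i)) ?_ ?_
  · have hmem : Icc 0 Tmax ∈ 𝓝 t := Icc_mem_nhds ht.1 ht.2
    have hd := (h.differentiableOn t (Ioo_subset_Icc_self ht)).hasDerivWithinAt.hasDerivAt hmem
    exact hasDerivAt_pi.1 hd i
  · have h1 : Continuous fun t => ζ' t ᵥ* (S.A (max 0 t) + S.Gc (max 0 t)) :=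
      hζ'.matrix_vecMul ((continuous_comp_max hA).add (continuous_comp_max hG))
    exact ((continuous_apply i).comp (h1.add continuous_const)).neg
  · intro t ht
    have := h.flow_state t (Ioo_subset_Icc_self ht) i
    rw [hζζ' t (Ioo_subset_Icc_self ht), max_eq_right ht.1.le]
    simp only [Pi.add_apply, Pi.zero_apply] at this ⊢
    linarith

/-- The jump inequality bounds `ζ θ` below by `ε` plus nonnegative terms. This argument covers only
`θ ∈ [Tmin, Tmax]`; the value at `Tmax` starts the backward Gronwall argument. -/
lemma apply_pos (h : S.IsCertificate Tmin Tmax ζ ε γ) (hpos : S.InternallyPositive)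
    (hA : ContinuousOn S.A (Ici 0)) (hG : ContinuousOn S.Gc (Ici 0))
    (hE : ContinuousOn S.Ec (Ici 0)) (hε : 0 < ε) {θ : ℝ} (hθ : θ ∈ Icc Tmin Tmax) (i : Fin n) :
    0 < ζ θ i := by
  obtain ⟨-, -, hJ, hC, -, -⟩ := hpos.entries_nonneg hA hG hE
  have h1 := h.jump_state θ hθ i
  have h2 := vecMul_nonneg (fun i => (h.zero_pos i).le) hJ i
  have h3 := vecMul_nonneg (v := (1 : Fin qd → ℝ)) (fun _ => zero_le_one) hC i
  simp only [Pi.add_apply, Pi.neg_apply, Pi.zero_apply] at h1 h2 h3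
  linarith

/-- Although `ζ` and the matrices `Gc` are only related by differential inequalities, positivity
of the system forces `ζ(τ)ᵀ G_c(τ) ≥ 0`. -/
lemma vecMul_Gc_nonneg (h : S.IsCertificate Tmin Tmax ζ ε γ) (hpos : S.InternallyPositive)
    (hA : ContinuousOn S.A (Ici 0)) (hG : ContinuousOn S.Gc (Ici 0))
    (hE : ContinuousOn S.Ec (Ici 0)) (hε : 0 < ε) (hT : Tmin ≤ Tmax) (hT0' : 0 < Tmax)
    {s : ℝ} (hs : s ∈ Icc 0 Tmax) : 0 ≤ ζ s ᵥ* S.Gc s := by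
  have hT0 := hT0'.le
  obtain ⟨ζ', hζ', hζζ'⟩ := h.exists_continuous_extension hT0
  obtain ⟨Φ, Ψ, hΦ⟩ := exists_isFundamentalPair (b := Tmax + 1) (continuous_comp_max hA)
    (by linarith)
  obtain ⟨hC, hH, -⟩ := hpos.entries_nonneg hA hG hE
  obtain ⟨K₁, hK₁, hΦK⟩ := exists_sum_abs_le Tmax hΦ.continuous
  obtain ⟨K₂, hK₂, hΨK⟩ := exists_sum_abs_le Tmax hΦ.continuous_inv
  obtain ⟨K₃, hK₃, hGK⟩ := exists_sum_abs_le Tmax (continuous_comp_max hG)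
  set μ : ℝ → Fin n → ℝ := fun s => ζ' s ᵥ* S.Gc (max 0 s) with hμ
  have hμc : Continuous μ := hζ'.matrix_vecMul (continuous_comp_max hG)
  -- The total negative part of `ζᵀ Gc`; a backward integral inequality for it shows that it
  -- vanishes.
  set u : ℝ → ℝ := fun s => ∑ j, max (-μ s j) 0 with hu
  have huc : Continuous u := by
    refine continuous_finsetSum _ fun j _ => ?_
    exact (((continuous_apply j).comp hμc).neg).max continuous_const
  have hu0 : ∀ s, 0 ≤ u s := fun s => Finset.sum_nonneg fun j _ => le_max_right _ _
  set K := K₁ * (K₂ * K₃) with hK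
  have hK0 : 0 ≤ K := by positivity
  have key : ∀ s ∈ Icc 0 Tmax, ∀ j, -μ s j ≤ K * ∫ r in s..Tmax, u r := by
    intro s hs j
    -- The solution of `p' = A p` with `p s` equal to column `j` of `Gc s`. Thus `ζ s ⬝ᵥ p s` is the
    -- entry to be bounded, and `p r` is nonnegative by `kernel_nonneg`.
    set p : ℝ → Fin n → ℝ := fun r => Φ r *ᵥ (Ψ s *ᵥ (S.Gc s *ᵥ Pi.single j 1)) with hp
    have hp0 : ∀ r ∈ Icc s Tmax, 0 < r → 0 ≤ p r := fun r hr hr0 i => by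
      have := hpos.kernel_nonneg hA hG hE hT0 hΦ ⟨hr0, hr.2⟩ ⟨hs.1, hr.1⟩ i j
      simp only [hp]
      rw [mulVec_mulVec, mulVec_mulVec, mulVec_single_one]
      exact this
    have hpK : ∀ r ∈ Icc 0 Tmax, ∀ i, p r i ≤ K := fun r hr i => by
      have h1 : ‖(Pi.single j 1 : Fin n → ℝ)‖ ≤ 1 := by
        refine (pi_norm_le_iff_of_nonneg zero_le_one).2 fun l => ?_
        by_cases hl : l = j
        · subst hl; simp
        · simp [Pi.single_eq_of_ne hl]
      have h3 := (norm_mulVec_le (S.Gc s) (Pi.single j 1)).trans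
        (mul_le_mul (by simpa [max_eq_right hs.1] using hGK s hs) h1 (norm_nonneg _) hK₃)
      rw [mul_one] at h3
      have h4 := (norm_mulVec_le (Ψ s) (S.Gc s *ᵥ Pi.single j 1)).trans
        (mul_le_mul (hΨK s hs) h3 (norm_nonneg _) hK₂)
      have h5 := (norm_mulVec_le (Φ r) (Ψ s *ᵥ (S.Gc s *ᵥ Pi.single j 1))).trans
        (mul_le_mul (hΦK r hr) h4 (norm_nonneg _) hK₁)
      exact (le_abs_self _).trans ((norm_le_pi_norm (p r) i).trans h5)
    have hpp : ∀ i, IsPrimitive Tmax (fun r => p r i) (fun r => (S.A (max 0 r) *ᵥ p r) i) := by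
      intro i
      refine (IsPrimitive.sum Finset.univ fun l _ => ((hΦ.isPrimitive i l).mono
        ⟨hT0, by linarith⟩).mul (IsPrimitive.const Tmax
          ((Ψ s *ᵥ (S.Gc s *ᵥ Pi.single j 1)) l)) hT0).congr_deriv hT0 fun r _ => ?_
      simp only [mul_zero, add_zero, hp]
      rw [mulVec_mulVec (M := S.A _)]
      rfl
    have hprod := IsPrimitive.sum Finset.univ fun i _ => (h.isPrimitive hA hG hT0 i).mul (hpp i) hT0
    have hTm : Tmax ∈ Icc 0 Tmax := ⟨hT0, le_rfl⟩
    have hsub := hprod.sub_eq hs hTm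
    have hζT : 0 ≤ ∑ i, ζ Tmax i * p Tmax i := by
      exact Finset.sum_nonneg fun i _ => mul_nonneg
        (h.apply_pos hpos hA hG hE hε ⟨hT, le_rfl⟩ i).le (hp0 Tmax ⟨hs.2, le_rfl⟩ hT0' i)
    have hζs : ∑ i, ζ s i * p s i = μ s j := by
      have h1 : p s = S.Gc s *ᵥ Pi.single j 1 := by
        simp only [hp]
        rw [mulVec_mulVec, hΦ.mul_inv s ⟨hs.1, by linarith [hs.2]⟩, one_mulVec]
      simp only [hμ, hζζ' s hs, max_eq_right hs.1, h1, mulVec_single_one]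
      rfl
    have hle : ∫ r in s..Tmax, (∑ i, (derivWithin ζ (Icc 0 Tmax) r i * p r i +
        ζ r i * (S.A (max 0 r) *ᵥ p r) i)) ≤ ∫ r in s..Tmax, K * u r := by
      refine intervalIntegral.integral_mono_on_of_le_Ioo hs.2
        (IsPrimitive.intervalIntegrable_of_mem hprod.1 hs hTm)
        ((huc.const_smul K).intervalIntegrable _ _) fun r hr => ?_
      have hr0 : 0 < r := hs.1.trans_lt hr.1
      have hr' : r ∈ Icc 0 Tmax := ⟨hr0.le, hr.2.le⟩
      have hpr := hp0 r ⟨hr.1.le, hr.2.le⟩ hr0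
      have e1 : ∑ i, (derivWithin ζ (Icc 0 Tmax) r i * p r i + ζ r i * (S.A (max 0 r) *ᵥ p r) i)
          = (derivWithin ζ (Icc 0 Tmax) r + ζ r ᵥ* S.A r) ⬝ᵥ p r := by
        rw [Finset.sum_add_distrib, add_dotProduct, max_eq_right hr0.le, ← dotProduct_mulVec]
        rfl
      rw [e1, hu, Finset.mul_sum]
      refine Finset.sum_le_sum fun i _ => ?_
      have hf := h.flow_state r hr' i
      have hcn := vecMul_nonneg (v := (1 : Fin qc → ℝ)) (M := S.Cc + S.Hc) (fun _ => zero_le_one)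
        (fun i j => add_nonneg (hC i j) (hH i j)) i
      have hμr : μ r i = (ζ r ᵥ* S.Gc r) i := by
        simp only [hμ, hζζ' r hr', max_eq_right hr0.le]
      simp only [vecMul_add, Pi.add_apply, Pi.zero_apply] at hf hcn
      -- The flow inequality with `Cc + Hc ≥ 0` gives `ζ' + ζᵀA ≤ -ζᵀGc`, so `ζ ⬝ᵥ p` grows at rate
      -- at most `K u`. As it is nonnegative at `Tmax`, it is at least `-K ∫ u` at `s`.
      have h1 : (derivWithin ζ (Icc 0 Tmax) r + ζ r ᵥ* S.A r) i ≤ max (-μ r i) 0 := by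
        refine le_trans ?_ (le_max_left _ _)
        rw [hμr, Pi.add_apply]
        linarith
      rw [mul_comm K]
      exact mul_le_mul h1 (hpK r hr' i) (hpr i) (le_max_right _ _)
    rw [← hsub, hζs, intervalIntegral.integral_const_mul] at hle
    linarith
  have hle0 : u s ≤ 0 := by
    refine nonpos_of_le_integral huc (L := n * K) (by positivity) (fun r hr => ?_) hs
    have hint : 0 ≤ ∫ t in r..Tmax, u t := intervalIntegral.integral_nonneg hr.2 fun t _ => hu0 t
    calc u r ≤ ∑ _j : Fin n, K * ∫ t in r..Tmax, u t :=
          Finset.sum_le_sum fun j _ => max_le (key r hr j) (mul_nonneg hK0 hint)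
      _ = _ := by
          rw [Finset.sum_const, Finset.card_univ, Fintype.card_fin, nsmul_eq_mul]
          ring
  intro j
  have h1 : max (-μ s j) 0 ≤ u s :=
    Finset.single_le_sum (f := fun j => max (-μ s j) 0) (fun j _ => le_max_right _ _)
      (Finset.mem_univ j)
  have h2 : -μ s j ≤ 0 := (le_max_left _ _).trans (h1.trans hle0)
  simp only [hμ, hζζ' s hs, max_eq_right hs.1] at h2
  simpa using h2

end Sys.IsCertificate
end ImpulsiveDelay

/-! ### Dissipation inequalities on one dwell interval and at one jump. -/

namespace ImpulsiveDelay

variable {n pc pd qc qd : ℕ}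

lemma intervalIntegrable_dotProduct {m : ℕ} {v f : ℝ → Fin m → ℝ} {a b : ℝ}
    (hv : ContinuousOn v (uIcc a b)) (hf : ∀ i, IntervalIntegrable (fun s => f s i) volume a b) :
    IntervalIntegrable (fun s => v s ⬝ᵥ f s) volume a b :=
  intervalIntegrable_finsetSum (f := fun i s => v s i * f s i) Finset.univ fun i _ =>
    (hf i).continuousOn_mul ((continuous_apply i).comp_continuousOn hv)

section Trajectory

variable {S : Sys n pc pd qc qd} {hc : ℝ} {hd : ℕ} {T : ℕ → ℝ} {φ : C(Icc (-hc) 0, Fin n → ℝ)}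
  {ψ : Fin hd → Fin n → ℝ} {wc : ℝ → Fin pc → ℝ} {wd : ℕ → Fin pd → ℝ} {x : ℝ → Fin n → ℝ}

namespace Sys.IsTrajectory

lemma intervalIntegrable_arc (h : S.IsTrajectory hc hd T φ ψ wc wd x) (hT : ∀ k, 0 < T k)
    (k : ℕ) (i : Fin n) :
    IntervalIntegrable (fun τ => x (impulseTime T k + τ) i) volume 0 (T k) := by
  have h1 := (h.isPrimitive_flow hT k i).continuousOn (hT k).le
  rw [← uIcc_of_le (hT k).le] at h1
  refine h1.intervalIntegrable.congr fun τ hτ => ?_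
  rw [uIoc_of_le (hT k).le] at hτ
  simp only [h.eq_arc hτ]

lemma intervalIntegrable (h : S.IsTrajectory hc hd T φ ψ wc wd x) (hhc : 0 ≤ hc)
    (hT : ∀ k, 0 < T k) (k : ℕ) (i : Fin n) :
    IntervalIntegrable (fun t => x t i) volume (-hc) (impulseTime T k) := by
  induction k with
  | zero =>
    rw [impulseTime_zero]
    have h1 : Continuous fun t => IccExtend (neg_nonpos.2 hhc) φ t i :=
      (continuous_apply i).comp φ.continuous.Icc_extend'
    refine (h1.intervalIntegrable (-hc) 0).congr fun t ht => ?_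
    rw [uIoc_of_le (neg_nonpos.2 hhc)] at ht
    have ht' : t ∈ Icc (-hc) 0 := Ioc_subset_Icc_self ht
    simp only [IccExtend_of_mem _ _ ht', h.init ⟨t, ht'⟩]
  | succ k ih =>
    refine ih.trans ?_
    have h2 := (h.intervalIntegrable_arc hT k i).comp_sub_right (impulseTime T k)
    rw [zero_add, add_comm (T k), ← impulseTime_succ] at h2
    simpa using h2

lemma intervalIntegrable_delayed (h : S.IsTrajectory hc hd T φ ψ wc wd x) (hhc : 0 ≤ hc)
    (hT : ∀ k, 0 < T k) (k : ℕ) (i : Fin n) :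
    IntervalIntegrable (fun τ => x (impulseTime T k + τ - hc) i) volume 0 (T k) := by
  have := intervalIntegrable_shift (f := fun t => x t i) (impulseTime T k - hc) 0 (T k)
    ((h.intervalIntegrable hhc hT (k + 1) i).mono_set ?_)
  · simpa only [sub_add_eq_add_sub] using this
  · have := impulseTime_nonneg hT k
    rw [impulseTime_succ, uIcc_of_le (by linarith [hT k]), uIcc_of_le (by linarith [hT k])]
    exact Icc_subset_Icc (by linarith) (by linarith)

lemma intervalIntegrable_zc (h : S.IsTrajectory hc hd T φ ψ wc wd x) (hhc : 0 ≤ hc)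
    (hT : ∀ k, 0 < T k) (hwc : IntegrableOn wc (Ioi 0)) (k : ℕ) (i : Fin qc) :
    IntervalIntegrable (fun τ => S.zc hc wc x (impulseTime T k + τ) i) volume 0 (T k) :=
  ((intervalIntegrable_mulVec_apply (h.intervalIntegrable_arc hT k) continuous_const i).add
    (intervalIntegrable_mulVec_apply (h.intervalIntegrable_delayed hhc hT k)
      continuous_const i)).add
    (intervalIntegrable_mulVec_apply (intervalIntegrable_input hwc (impulseTime_nonneg hT k)
      (hT k).le) continuous_const i)

end Sys.IsTrajectory

variable {Tmin Tmax ε γ : ℝ} {ζ : ℝ → Fin n → ℝ}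

/-- The weight of the continuous-time delayed state in the Lyapunov functional. -/
noncomputable def Sys.flowWeight (S : Sys n pc pd qc qd) (ζ : ℝ → Fin n → ℝ) (τ : ℝ) : Fin n → ℝ :=
  ζ τ ᵥ* S.Gc τ + 1 ᵥ* S.Hc

/-- The weight of the discrete-time delayed state in the Lyapunov functional. -/
noncomputable def Sys.jumpWeight (S : Sys n pc pd qc qd) (ζ : ℝ → Fin n → ℝ) : Fin n → ℝ :=
  ζ 0 ᵥ* S.Gd + 1 ᵥ* S.Hd

namespace Sys.IsCertificate

lemma continuousOn_flowWeight (h : S.IsCertificate Tmin Tmax ζ ε γ)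
    (hG : ContinuousOn S.Gc (Ici 0)) : ContinuousOn (S.flowWeight ζ) (Icc 0 Tmax) := by
  have h1 : Continuous fun p : (Fin n → ℝ) × Matrix (Fin n) (Fin n) ℝ => p.1 ᵥ* p.2 :=
    continuous_fst.matrix_vecMul continuous_snd
  exact (h1.comp_continuousOn (h.differentiableOn.continuousOn.prodMk
    (hG.mono Icc_subset_Ici_self))).add continuousOn_const

/-- The certificate puts `Gc + Hc` against the current state, while the dynamics and the output put
them against the delayed state. The two `flowWeight` integrals are exactly this discrepancy in the
derivative of `ζ ⬝ᵥ x`. -/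
lemma flow_inequality (h : S.IsCertificate Tmin Tmax ζ ε γ) (hA : ContinuousOn S.A (Ici 0))
    (hG : ContinuousOn S.Gc (Ici 0)) (hhc : 0 ≤ hc) (hT : ∀ k, 0 < T k)
    (hwc : IntegrableOn wc (Ioi 0)) (hx : S.IsTrajectory hc hd T φ ψ wc wd x)
    (hx0 : ∀ t, 0 ≤ t → 0 ≤ x t) (hw0 : ∀ t, 0 ≤ t → 0 ≤ wc t) {k : ℕ} (hTk : T k ≤ Tmax) :
    ζ (T k) ⬝ᵥ x (impulseTime T (k + 1))
      + (∫ τ in (0 : ℝ)..T k, S.flowWeight ζ τ ⬝ᵥ x (impulseTime T k + τ))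
      + (∫ τ in (0 : ℝ)..T k, 1 ⬝ᵥ S.zc hc wc x (impulseTime T k + τ)) ≤
    ζ 0 ⬝ᵥ S.afterJump hd T ψ wd x k
      + (∫ τ in (0 : ℝ)..T k, S.flowWeight ζ τ ⬝ᵥ x (impulseTime T k + τ - hc))
      + γ * ∫ τ in (0 : ℝ)..T k, 1 ⬝ᵥ wc (impulseTime T k + τ) := by
  have hTk0 := hT k
  have hTmax : 0 ≤ Tmax := hTk0.le.trans hTk
  have htk := impulseTime_nonneg hT k
  set X := S.arc hc hd T ψ wc wd x k with hX
  set f := S.flow hc T wc x k with hf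
  have hκ : ContinuousOn (S.flowWeight ζ) (uIcc 0 (T k)) := by
    rw [uIcc_of_le hTk0.le]
    exact (h.continuousOn_flowWeight hG).mono (Icc_subset_Icc_right hTk)
  have i1 := intervalIntegrable_dotProduct hκ (hx.intervalIntegrable_arc hT k)
  have i2 := intervalIntegrable_dotProduct hκ (hx.intervalIntegrable_delayed hhc hT k)
  have i3 := intervalIntegrable_dotProduct (v := fun _ => 1) continuousOn_const
    (hx.intervalIntegrable_zc hhc hT hwc k)
  have i4 := intervalIntegrable_dotProduct (v := fun _ => 1) continuousOn_const
    (intervalIntegrable_input hwc htk hTk0.le)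
  have hprod := IsPrimitive.sum Finset.univ fun i _ =>
    ((h.isPrimitive hA hG hTmax i).mono ⟨hTk0.le, hTk⟩).mul (hx.isPrimitive_flow hT k i) hTk0.le
  have hend : ∑ i, ζ (T k) i * X (T k) i = ∑ i, ζ 0 i * X 0 i +
      ∫ τ in (0 : ℝ)..T k, ∑ i, (derivWithin ζ (Icc 0 Tmax) τ i * X τ i + ζ τ i * f τ i) :=
    hprod.2 (T k) ⟨hTk0.le, le_rfl⟩
  have hle : ∫ τ in (0 : ℝ)..T k, ∑ i, (derivWithin ζ (Icc 0 Tmax) τ i * X τ i + ζ τ i * f τ i) ≤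
      ∫ τ in (0 : ℝ)..T k, (S.flowWeight ζ τ ⬝ᵥ x (impulseTime T k + τ - hc)
        - S.flowWeight ζ τ ⬝ᵥ x (impulseTime T k + τ)
        - 1 ⬝ᵥ S.zc hc wc x (impulseTime T k + τ) + γ * 1 ⬝ᵥ wc (impulseTime T k + τ)) := by
    refine intervalIntegral.integral_mono_on_of_le_Ioo hTk0.le hprod.1
      (((i2.sub i1).sub i3).add (i4.const_mul γ)) fun τ hτ => ?_
    have hτ' : τ ∈ Icc 0 Tmax := ⟨hτ.1.le, hτ.2.le.trans hTk⟩
    rw [hX, ← hx.eq_arc ⟨hτ.1, hτ.2.le⟩]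
    have e1 : ∑ i, (derivWithin ζ (Icc 0 Tmax) τ i * x (impulseTime T k + τ) i + ζ τ i * f τ i)
        = derivWithin ζ (Icc 0 Tmax) τ ⬝ᵥ x (impulseTime T k + τ) + ζ τ ⬝ᵥ f τ :=
      Finset.sum_add_distrib
    have g1 := dotProduct_le_dotProduct_of_nonneg_right (h.flow_state τ hτ')
      (hx0 (impulseTime T k + τ) (by linarith [hτ.1]))
    have g2 := dotProduct_le_dotProduct_of_nonneg_right (h.flow_input τ hτ')
      (hw0 (impulseTime T k + τ) (by linarith [hτ.1]))
    have e2 : (fun _ => γ) ⬝ᵥ wc (impulseTime T k + τ) = γ * 1 ⬝ᵥ wc (impulseTime T k + τ) := by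
      simp [dotProduct, Finset.mul_sum]
    rw [e1, hf]
    rw [e2] at g2
    simp only [Sys.flow, Sys.zc, Sys.flowWeight, dotProduct_add, add_dotProduct, dotProduct_mulVec,
      vecMul_add, zero_dotProduct] at g1 g2 ⊢
    linarith
  rw [intervalIntegral.integral_add ((i2.sub i1).sub i3) (i4.const_mul γ),
    intervalIntegral.integral_sub (i2.sub i1) i3, intervalIntegral.integral_sub i2 i1,
    intervalIntegral.integral_const_mul] at hle
  have e3 : ∑ i, ζ (T k) i * X (T k) i = ζ (T k) ⬝ᵥ x (impulseTime T (k + 1)) := by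
    rw [hX, ← hx.eq_arc ⟨hTk0, le_rfl⟩, impulseTime_succ]
    rfl
  have e4 : ∑ i, ζ 0 i * X 0 i = ζ 0 ⬝ᵥ S.afterJump hd T ψ wd x k := by
    rw [hX, S.arc_zero]
    rfl
  rw [e3, e4] at hend
  linarith

lemma jump_inequality (h : S.IsCertificate Tmin Tmax ζ ε γ) {θ : ℝ} (hθ : θ ∈ Icc Tmin Tmax)
    {k : ℕ} (hx0 : 0 ≤ x (impulseTime T (k + 1))) (hw0 : 0 ≤ wd (k + 1)) :
    ζ 0 ⬝ᵥ S.afterJump hd T ψ wd x (k + 1) + S.jumpWeight ζ ⬝ᵥ x (impulseTime T (k + 1))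
      + 1 ⬝ᵥ S.zd hd T ψ wd x (k + 1) + ε * 1 ⬝ᵥ x (impulseTime T (k + 1)) ≤
    ζ θ ⬝ᵥ x (impulseTime T (k + 1)) + S.jumpWeight ζ ⬝ᵥ delayedSample hd T ψ x (k + 1)
      + γ * 1 ⬝ᵥ wd (k + 1) := by
  have g1 := dotProduct_le_dotProduct_of_nonneg_right (h.jump_state θ hθ) hx0
  have g2 := dotProduct_le_dotProduct_of_nonneg_right h.jump_input hw0
  have e1 : (fun _ => -ε) ⬝ᵥ x (impulseTime T (k + 1)) =
      -(ε * 1 ⬝ᵥ x (impulseTime T (k + 1))) := by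
    simp [dotProduct, Finset.mul_sum]
  have e2 : (fun _ => γ) ⬝ᵥ wd (k + 1) = γ * 1 ⬝ᵥ wd (k + 1) := by
    simp [dotProduct, Finset.mul_sum]
  rw [e1] at g1
  rw [e2] at g2
  simp only [Sys.afterJump, if_neg k.succ_ne_zero, Sys.zd, Sys.jumpWeight, dotProduct_add,
    add_dotProduct, dotProduct_mulVec, vecMul_add, neg_dotProduct] at g1 g2 ⊢
  linarith

end Sys.IsCertificate

end Trajectory

/-- This is how delayed terms `e` are absorbed by undelayed terms `d`: after the first `N` of them,
which involve initial data, they are dominated by the shifted sequence `d`. -/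
lemma sum_le_of_shift_le {e d : ℕ → ℝ} {N : ℕ} {B : ℝ} (he : ∀ k, 0 ≤ e k)
    (hed : ∀ k, e (k + N) ≤ d k) (hB : ∑ k ∈ Finset.range N, e k ≤ B) (M : ℕ) :
    ∑ k ∈ Finset.range M, e k ≤ ∑ k ∈ Finset.range M, d k + B := by
  calc ∑ k ∈ Finset.range M, e k ≤ ∑ k ∈ Finset.range (N + M), e k :=
        Finset.sum_le_sum_of_subset_of_nonneg (Finset.range_mono (by omega)) fun k _ _ => he k
    _ = ∑ k ∈ Finset.range N, e k + ∑ k ∈ Finset.range M, e (N + k) :=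
        Finset.sum_range_add _ _ _
    _ ≤ B + ∑ k ∈ Finset.range M, d k :=
        add_le_add hB (Finset.sum_le_sum fun k _ => by rw [add_comm]; exact hed k)
    _ = _ := add_comm _ _

/-! ### Periodic dwell-times whose period divides the delay. -/

section Periodic

variable {Tmin Tmax hc : ℝ} {T : ℕ → ℝ}

lemma impulseTime_period_mul {q : ℕ} (hq : ∀ k, T (k + q) = T k) (m : ℕ) :
    impulseTime T (q * m) = m * impulseTime T q := by
  induction m with
  | zero => simp [impulseTime]
  | succ m ih =>
    have h1 : ∀ i, T (q * m + i) = T i := fun i => by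
      have := (show Function.Periodic T q from hq).nat_mul m i
      rwa [Nat.cast_id, mul_comm, add_comm] at this
    rw [Nat.mul_succ, impulseTime, Finset.sum_range_add]
    simp only [h1]
    rw [← impulseTime, ih, ← impulseTime]
    push_cast
    ring

/-- The period `q` may cover only the fraction `1 / α` of the delay; `N = q α` dwell-times cover it
exactly. A shift by `N` impulses is then a time shift by `hc` which preserves the timer. -/
lemma exists_period (hT : T ∈ periodicRangeDwell Tmin Tmax hc) :
    ∃ N, 0 < N ∧ (∀ k, T (k + N) = T k) ∧ impulseTime T N = hc := by
  obtain ⟨hpos, q, α, β, hq, hα, hβ, hTβ, hsum⟩ := hT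
  have hper : ∀ k, T (k + q) = T k := fun k => by
    have hk := Nat.div_add_mod k q
    have hlt := Nat.mod_lt k hq
    rw [← hk, show q * (k / q) + k % q + q = q * (k / q + 1) + k % q by ring, hTβ _ _ hlt,
      hTβ _ _ hlt]
  refine ⟨q * α, Nat.mul_pos hq hα, fun k => ?_, ?_⟩
  · have := (show Function.Periodic T q from hper).nat_mul α k
    simpa [mul_comm] using this
  · rw [impulseTime_period_mul hper, impulseTime, hsum]
    field_simp

lemma mem_Icc_of_mem_periodicRangeDwell (hT : T ∈ periodicRangeDwell Tmin Tmax hc) (k : ℕ) :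
    T k ∈ Icc Tmin Tmax := by
  obtain ⟨-, q, α, β, hq, -, hβ, hTβ, -⟩ := hT
  rw [← Nat.div_add_mod k q, hTβ _ _ (Nat.mod_lt k hq)]
  exact hβ _ (Nat.mod_lt k hq)

lemma impulseTime_add_period {N : ℕ} (hN : ∀ k, T (k + N) = T k) (hNc : impulseTime T N = hc)
    (k : ℕ) : impulseTime T (k + N) = impulseTime T k + hc := by
  rw [add_comm k, impulseTime, Finset.sum_range_add, ← impulseTime, hNc, add_comm]
  congr 1
  exact Finset.sum_congr rfl fun i _ => by rw [add_comm, hN]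

lemma isDwellSeq_of_mem_periodicRangeDwell (hhc : 0 < hc)
    (hT : T ∈ periodicRangeDwell Tmin Tmax hc) : IsDwellSeq T := by
  obtain ⟨N, hN0, hN, hNc⟩ := exists_period hT
  refine ⟨hT.1, tendsto_atTop_atTop_of_monotone (impulseTime_mono hT.1) fun b => ?_⟩
  obtain ⟨m, hm⟩ := exists_nat_ge (b / hc)
  exact ⟨N * m, by rwa [impulseTime_period_mul hN, hNc, ← div_le_iff₀ hhc]⟩

lemma le_of_mem_periodicRangeDwell (hT : T ∈ periodicRangeDwell Tmin Tmax hc) (k : ℕ) :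
    T k ≤ hc := by
  obtain ⟨N, hN0, hN, hNc⟩ := exists_period hT
  have h1 : T k = T (k % N) := ((show Function.Periodic T N from hN).map_mod_nat k).symm
  rw [h1, ← hNc]
  exact Finset.single_le_sum (f := T) (fun i _ => (hT.1 i).le)
    (Finset.mem_range.2 (Nat.mod_lt k hN0))

end Periodic

end ImpulsiveDelay

/-! ### The summed inequality, and bounds between impulses. -/

namespace ImpulsiveDelay

variable {n pc pd qc qd : ℕ}

lemma dotProduct_le_sum_mul {m : ℕ} {v y : Fin m → ℝ} {R : ℝ} (hv : 0 ≤ v) (hy : ‖y‖ ≤ R) :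
    v ⬝ᵥ y ≤ (∑ i, v i) * R := by
  rw [Finset.sum_mul]
  exact Finset.sum_le_sum fun i _ => mul_le_mul_of_nonneg_left
    ((le_abs_self _).trans ((norm_le_pi_norm y i).trans hy)) (hv i)

lemma norm_le_one_dotProduct {m : ℕ} {y : Fin m → ℝ} (hy : 0 ≤ y) : ‖y‖ ≤ 1 ⬝ᵥ y := by
  rw [one_dotProduct]
  refine (pi_norm_le_iff_of_nonneg (Finset.sum_nonneg fun i _ => hy i)).2 fun i => ?_
  rw [Real.norm_of_nonneg (hy i)]
  exact Finset.single_le_sum (fun i _ => hy i) (Finset.mem_univ i)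

variable {S : Sys n pc pd qc qd} {hc : ℝ} {hd : ℕ} {T : ℕ → ℝ} {φ : C(Icc (-hc) 0, Fin n → ℝ)}
  {ψ : Fin hd → Fin n → ℝ} {wc : ℝ → Fin pc → ℝ} {wd : ℕ → Fin pd → ℝ} {x : ℝ → Fin n → ℝ}
  {Tmin Tmax ε γ : ℝ} {ζ : ℝ → Fin n → ℝ}

lemma Sys.IsTrajectory.norm_le_of_mem_Icc (hx : S.IsTrajectory hc hd T φ ψ wc wd x) {s : ℝ}
    (hs : s ∈ Icc (-hc) 0) : ‖x s‖ ≤ ‖(φ, ψ)‖ := by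
  rw [hx.init ⟨s, hs⟩]
  exact (φ.norm_coe_le_norm _).trans (norm_fst_le (φ, ψ))

lemma Sys.IsTrajectory.nonneg_of_mem_Icc (hx : S.IsTrajectory hc hd T φ ψ wc wd x)
    (hφ : ∀ s, 0 ≤ φ s) (hx0 : ∀ t, 0 ≤ t → 0 ≤ x t) {s : ℝ} (hs : -hc ≤ s) : 0 ≤ x s := by
  rcases le_total s 0 with h | h
  · rw [hx.init ⟨s, hs, h⟩]
    exact hφ _
  · exact hx0 s h

namespace Sys.IsCertificate

/-- The central estimate: the flow and jump inequalities are added and summed over `k`. The `ζ`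
terms telescope, and the delayed terms are absorbed by `sum_le_of_shift_le`. `K` is independent of
the dwell-time sequence, as uniform stability and gain require. -/
lemma sum_le_of_nonneg (h : S.IsCertificate Tmin Tmax ζ ε γ) (hpos : S.InternallyPositive)
    (hA : ContinuousOn S.A (Ici 0)) (hG : ContinuousOn S.Gc (Ici 0))
    (hE : ContinuousOn S.Ec (Ici 0)) (hε : 0 < ε) (hTT : Tmin ≤ Tmax) (hhc : 0 < hc) (hd : ℕ) :
    ∃ K, 0 ≤ K ∧ ∀ T ∈ periodicRangeDwell Tmin Tmax hc, ∀ (φ : C(Icc (-hc) 0, Fin n → ℝ))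
      (ψ : Fin hd → Fin n → ℝ) (wc : ℝ → Fin pc → ℝ) (wd : ℕ → Fin pd → ℝ) (x : ℝ → Fin n → ℝ),
      IntegrableOn wc (Ioi 0) → S.IsTrajectory hc hd T φ ψ wc wd x → (∀ s, 0 ≤ φ s) →
      (∀ m, 0 ≤ ψ m) → (∀ t, 0 ≤ t → 0 ≤ wc t) → (∀ k, 1 ≤ k → 0 ≤ wd k) →
      (∀ t, 0 ≤ t → 0 ≤ x t) → ∀ M,
      ∑ k ∈ Finset.range M, ((∫ τ in (0 : ℝ)..T k, 1 ⬝ᵥ S.zc hc wc x (impulseTime T k + τ))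
          + 1 ⬝ᵥ S.zd hd T ψ wd x (k + 1) + ε * 1 ⬝ᵥ x (impulseTime T (k + 1))) ≤
        ∑ k ∈ Finset.range M, γ * ((∫ τ in (0 : ℝ)..T k, 1 ⬝ᵥ wc (impulseTime T k + τ))
          + 1 ⬝ᵥ wd (k + 1)) + K * ‖(φ, ψ)‖ := by
  obtain ⟨-, hH, -, -, hGd, hHd⟩ := hpos.entries_nonneg hA hG hE
  have hζ0 : 0 ≤ ζ 0 := fun i => (h.zero_pos i).le
  have hl : 0 ≤ S.jumpWeight ζ := add_nonneg (vecMul_nonneg hζ0 hGd)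
    (vecMul_nonneg (fun _ => zero_le_one) hHd)
  obtain ⟨L, hL⟩ : ∃ L, ∀ τ ∈ Icc 0 Tmax, ∑ i, S.flowWeight ζ τ i ≤ L := by
    have hcont : ContinuousOn (fun τ => ∑ i, S.flowWeight ζ τ i) (Icc 0 Tmax) :=
      continuousOn_finsetSum _ fun i _ =>
        (continuous_apply i).comp_continuousOn (h.continuousOn_flowWeight hG)
    obtain ⟨L, hL⟩ := isCompact_Icc.exists_bound_of_continuousOn hcont
    exact ⟨L, fun τ hτ => (le_abs_self _).trans (hL τ hτ)⟩
  -- Contributions of the initial state, of the initial function over a window of length `hc`, and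
  -- of the `hd` stored samples.
  set K := (∑ i, ζ 0 i) + (max L 0 * hc + hd * ∑ i, S.jumpWeight ζ i) with hK
  have hl0 : 0 ≤ ∑ i, S.jumpWeight ζ i := Finset.sum_nonneg fun i _ => hl i
  have hζ0s : 0 ≤ ∑ i, ζ 0 i := Finset.sum_nonneg fun i _ => hζ0 i
  refine ⟨K, by positivity, fun T hT φ ψ wc wd x hwc hx hφ hψ hwc0 hwd0 hx0 M => ?_⟩
  obtain ⟨N, -, hN, hNc⟩ := exists_period hT
  have hTpos := hT.1
  have hTmem := mem_Icc_of_mem_periodicRangeDwell hT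
  have hTmax : 0 < Tmax := (hTpos 0).trans_le (hTmem 0).2
  have htk := impulseTime_nonneg hTpos
  have hxt : ∀ k, 0 ≤ x (impulseTime T k) := fun k => hx0 _ (htk k)
  have hκ0 : ∀ τ ∈ Icc 0 Tmax, 0 ≤ S.flowWeight ζ τ := fun τ hτ =>
    add_nonneg (h.vecMul_Gc_nonneg hpos hA hG hE hε hTT hTmax hτ)
      (vecMul_nonneg (fun _ => zero_le_one) hH)
  set R := ‖(φ, ψ)‖ with hR
  have hR0 : 0 ≤ R := norm_nonneg _
  set a : ℕ → ℝ := fun k => ∫ τ in (0 : ℝ)..T k, S.flowWeight ζ τ ⬝ᵥ x (impulseTime T k + τ)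
    with ha
  set b : ℕ → ℝ := fun k => ∫ τ in (0 : ℝ)..T k,
    S.flowWeight ζ τ ⬝ᵥ x (impulseTime T k + τ - hc) with hb
  set d : ℕ → ℝ := fun k => S.jumpWeight ζ ⬝ᵥ x (impulseTime T (k + 1)) with hdd
  set e : ℕ → ℝ := fun k => S.jumpWeight ζ ⬝ᵥ delayedSample hd T ψ x (k + 1) with he
  have hsub : ∀ k, ∀ τ ∈ Icc 0 (T k), τ ∈ Icc 0 Tmax := fun k τ hτ =>
    ⟨hτ.1, hτ.2.trans (hTmem k).2⟩
  have hb0 : ∀ k, 0 ≤ b k := fun k => intervalIntegral.integral_nonneg (hTpos k).le fun τ hτ =>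
    dotProduct_nonneg_of_nonneg (hκ0 τ (hsub k τ hτ))
      (hx.nonneg_of_mem_Icc hφ hx0 (by linarith [htk k, hτ.1]))
  -- Periodicity is essential here: the delayed state on interval `k + N` is the state on interval
  -- `k` at the same timer value, hence with the same weight.
  have hba : ∀ k, b (k + N) ≤ a k := fun k => by
    simp only [hb, ha, hN, impulseTime_add_period hN hNc]
    refine le_of_eq (intervalIntegral.integral_congr fun τ _ => ?_)
    congr 2
    ring
  have hbN : ∑ k ∈ Finset.range N, b k ≤ max L 0 * hc * R := by
    have hbk : ∀ k ∈ Finset.range N, b k ≤ max L 0 * R * T k := fun k hk => by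
      have hkN : impulseTime T k + T k ≤ hc := by
        rw [← impulseTime_succ, ← hNc]
        exact impulseTime_mono hTpos (Finset.mem_range.1 hk)
      have hκ : ContinuousOn (S.flowWeight ζ) (uIcc 0 (T k)) := by
        rw [uIcc_of_le (hTpos k).le]
        exact (h.continuousOn_flowWeight hG).mono (hsub k)
      have := intervalIntegral.integral_mono_on (hTpos k).le
        (intervalIntegrable_dotProduct hκ (hx.intervalIntegrable_delayed hhc.le hTpos k))
        (intervalIntegrable_const (c := max L 0 * R)) fun τ hτ =>
          (dotProduct_le_sum_mul (hκ0 τ (hsub k τ hτ)) (hx.norm_le_of_mem_Icc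
            ⟨by linarith [htk k, hτ.1], by linarith [hτ.2]⟩)).trans
          (mul_le_mul_of_nonneg_right ((hL τ (hsub k τ hτ)).trans (le_max_left _ _)) hR0)
      rw [intervalIntegral.integral_const, sub_zero, smul_eq_mul, mul_comm] at this
      exact this
    refine (Finset.sum_le_sum hbk).trans (le_of_eq ?_)
    rw [← Finset.mul_sum, show ∑ k ∈ Finset.range N, T k = hc from hNc]
    ring
  have hdel : ∀ k, 0 ≤ delayedSample hd T ψ x k := fun k => by
    unfold delayedSample
    split_ifs
    · exact hxt _
    · exact hψ _
  have hed : ∀ k, e (k + hd) ≤ d k := fun k => by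
    simp only [he, hdd, delayedSample]
    rw [dif_pos (by omega), show k + hd + 1 - hd = k + 1 by omega]
  have hehd : ∑ k ∈ Finset.range hd, e k ≤ hd * (∑ i, S.jumpWeight ζ i) * R := by
    have hek : ∀ k ∈ Finset.range hd, e k ≤ (∑ i, S.jumpWeight ζ i) * R := fun k hk => by
      refine dotProduct_le_sum_mul hl ?_
      have hk' := Finset.mem_range.1 hk
      unfold delayedSample
      split_ifs
      · rw [show k + 1 - hd = 0 by omega, impulseTime_zero]
        exact hx.norm_le_of_mem_Icc ⟨by linarith, le_rfl⟩
      · exact (norm_le_pi_norm ψ _).trans (norm_snd_le (φ, ψ))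
    refine (Finset.sum_le_sum hek).trans (le_of_eq ?_)
    rw [Finset.sum_const, Finset.card_range, nsmul_eq_mul]
    ring
  have hsumb := sum_le_of_shift_le hb0 hba hbN M
  have hsume := sum_le_of_shift_le (fun k => dotProduct_nonneg_of_nonneg hl (hdel (k + 1)))
    hed hehd M
  set s : ℕ → ℝ := fun k => ζ 0 ⬝ᵥ S.afterJump hd T ψ wd x k with hs
  have hs0 : s 0 ≤ (∑ i, ζ 0 i) * R := by
    simp only [hs, Sys.afterJump, if_true]
    exact dotProduct_le_sum_mul hζ0 (hx.norm_le_of_mem_Icc ⟨by linarith, le_rfl⟩)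
  have hsM : 0 ≤ s M := dotProduct_nonneg_of_nonneg hζ0 (hx.afterJump_nonneg hTpos hx0 M)
  -- Taking `θ = T k` in the jump inequality cancels the term `ζ (T k) ⬝ᵥ x (t_{k+1})` of the flow
  -- inequality.
  have hstep : ∀ k ∈ Finset.range M,
      (s (k + 1) - s k) + (∫ τ in (0 : ℝ)..T k, 1 ⬝ᵥ S.zc hc wc x (impulseTime T k + τ))
          + 1 ⬝ᵥ S.zd hd T ψ wd x (k + 1) + ε * 1 ⬝ᵥ x (impulseTime T (k + 1)) + a k + d k ≤
        γ * ((∫ τ in (0 : ℝ)..T k, 1 ⬝ᵥ wc (impulseTime T k + τ)) + 1 ⬝ᵥ wd (k + 1))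
          + b k + e k := fun k _ => by
    have h1 := h.flow_inequality hA hG hhc.le hTpos hwc hx hx0 hwc0 (hTmem k).2
    have h2 := h.jump_inequality (hd := hd) (ψ := ψ) (hTmem k) (hxt (k + 1))
      (hwd0 (k + 1) (by omega))
    simp only [hs, ha, hb, hdd, he]
    linarith
  have htot := Finset.sum_le_sum hstep
  simp only [Finset.sum_add_distrib, Finset.sum_range_sub] at htot ⊢
  have hKR : K * R = (∑ i, ζ 0 i) * R + (max L 0 * hc * R +
      hd * (∑ i, S.jumpWeight ζ i) * R) := by rw [hK]; ring
  rw [hKR]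
  linarith

end Sys.IsCertificate

/-- Between two impulses, a nonnegative unforced trajectory is controlled by its value at the end
of the interval. -/
lemma Sys.InternallyPositive.exists_norm_le (hpos : S.InternallyPositive)
    (hA : ContinuousOn S.A (Ici 0)) (hG : ContinuousOn S.Gc (Ici 0))
    (hE : ContinuousOn S.Ec (Ici 0)) (hTmax : 0 ≤ Tmax) (hhc : 0 ≤ hc) (hd : ℕ) :
    ∃ C, 0 ≤ C ∧ ∀ T : ℕ → ℝ, (∀ k, 0 < T k) → (∀ k, T k ≤ Tmax) →
      ∀ (φ : C(Icc (-hc) 0, Fin n → ℝ)) (ψ : Fin hd → Fin n → ℝ) (x : ℝ → Fin n → ℝ),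
      S.IsTrajectory hc hd T φ ψ 0 0 x → (∀ s, 0 ≤ φ s) → (∀ t, 0 ≤ t → 0 ≤ x t) →
      ∀ k, ∀ τ ∈ Ioc 0 (T k), ‖x (impulseTime T k + τ)‖ ≤ C * ‖x (impulseTime T (k + 1))‖ := by
  obtain ⟨Φ, Ψ, hΦ⟩ := exists_isFundamentalPair (b := Tmax + 1) (continuous_comp_max hA)
    (by linarith)
  obtain ⟨K₁, hK₁, hΦK⟩ := exists_sum_abs_le Tmax hΦ.continuous
  obtain ⟨K₂, hK₂, hΨK⟩ := exists_sum_abs_le Tmax hΦ.continuous_inv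
  refine ⟨K₁ * K₂, by positivity, fun T hT hTT φ ψ x hx hφ hx0 k τ hτ => ?_⟩
  have hTk := hT k
  have htk := impulseTime_nonneg hT k
  set F : ℝ → Fin n → ℝ := fun s => Ψ s *ᵥ (S.Gc (max 0 s) *ᵥ x (impulseTime T k + s - hc)) with hF
  have hFint : ∀ i, IntervalIntegrable (fun s => F s i) volume 0 (T k) :=
    intervalIntegrable_mulVec_apply (intervalIntegrable_mulVec_apply
      (hx.intervalIntegrable_delayed hhc hT k) (continuous_comp_max hG)) hΦ.continuous_inv
  -- The arc is `Φ r *ᵥ g r`. Nonnegativity of the kernel makes `Φ (T k) *ᵥ g r` nondecreasing in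
  -- `r`, from a nonnegative start up to `x (t_{k+1})`.
  set g : ℝ → Fin n → ℝ := fun r i => S.afterJump hd T ψ 0 x k i + ∫ s in (0 : ℝ)..r, F s i with hg
  have harc : ∀ r ∈ Ioc 0 (T k), x (impulseTime T k + r) = Φ r *ᵥ g r := fun r hr => by
    rw [hx.eq_arc hr, hx.arc_eq_mulVec hT hΦ (by linarith [hTT k]) (Ioc_subset_Icc_self hr)]
    simp [hg, hF]
  have hsub : ∀ r ∈ Icc 0 (T k), ∀ i, IntervalIntegrable (fun s => F s i) volume 0 r :=
    fun r hr i =>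
    IsPrimitive.intervalIntegrable_of_mem (hFint i) ⟨le_rfl, hTk.le⟩ hr
  have hFg : ∀ r ∈ Icc 0 (T k), ∀ i, (Φ (T k) *ᵥ g r) i =
      (Φ (T k) *ᵥ S.afterJump hd T ψ 0 x k) i + ∫ s in (0 : ℝ)..r, (Φ (T k) *ᵥ F s) i := by
    intro r hr i
    have h1 : ∫ s in (0 : ℝ)..r, (Φ (T k) *ᵥ F s) i
        = ∑ l, Φ (T k) i l * ∫ s in (0 : ℝ)..r, F s l := by
      simp only [mulVec, dotProduct]
      rw [intervalIntegral.integral_finsetSum fun l _ => (hsub r hr l).const_mul _]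
      simp only [intervalIntegral.integral_const_mul]
    rw [h1]
    simp only [mulVec, dotProduct, hg, mul_add, Finset.sum_add_distrib]
  have hF0 : ∀ s ∈ Icc 0 (T k), ∀ i, 0 ≤ (Φ (T k) *ᵥ F s) i := by
    intro s hs i
    simp only [hF, max_eq_right hs.1]
    rw [mulVec_mulVec, mulVec_mulVec]
    exact dotProduct_nonneg_of_nonneg
      (fun j => hpos.kernel_nonneg hA hG hE hTmax hΦ ⟨hTk, hTT k⟩ hs i j)
      (hx.nonneg_of_mem_Icc hφ hx0 (by linarith [hs.1]))
  have hΦFint : ∀ i, IntervalIntegrable (fun s => (Φ (T k) *ᵥ F s) i) volume 0 (T k) :=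
    intervalIntegrable_mulVec_apply hFint continuous_const
  have hΦs : ∀ i, 0 ≤ (Φ (T k) *ᵥ S.afterJump hd T ψ 0 x k) i := fun i =>
    dotProduct_nonneg_of_nonneg
      (fun j => hpos.fundamental_nonneg hA hG hE hΦ ⟨hTk, hTT k⟩ i j)
      (hx.afterJump_nonneg hT hx0 k)
  have hτ' : τ ∈ Icc 0 (T k) := Ioc_subset_Icc_self hτ
  have hTk' : T k ∈ Icc 0 (T k) := ⟨hTk.le, le_rfl⟩
  have hend : x (impulseTime T (k + 1)) = Φ (T k) *ᵥ g (T k) := by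
    rw [impulseTime_succ, harc _ ⟨hTk, le_rfl⟩]
  have hnorm : ‖Φ (T k) *ᵥ g τ‖ ≤ ‖x (impulseTime T (k + 1))‖ := by
    refine (pi_norm_le_iff_of_nonneg (norm_nonneg _)).2 fun i => ?_
    refine le_trans ?_ (norm_le_pi_norm (x (impulseTime T (k + 1))) i)
    have h1 : 0 ≤ ∫ s in (0 : ℝ)..τ, (Φ (T k) *ᵥ F s) i :=
      intervalIntegral.integral_nonneg hτ.1.le fun s hs => hF0 s ⟨hs.1, hs.2.trans hτ.2⟩ i
    have h2 : 0 ≤ ∫ s in τ..T k, (Φ (T k) *ᵥ F s) i :=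
      intervalIntegral.integral_nonneg hτ.2 fun s hs => hF0 s ⟨hτ.1.le.trans hs.1, hs.2⟩ i
    have h3 := intervalIntegral.integral_add_adjacent_intervals
      (IsPrimitive.intervalIntegrable_of_mem (hΦFint i) ⟨le_rfl, hTk.le⟩ hτ')
      (IsPrimitive.intervalIntegrable_of_mem (hΦFint i) hτ' hTk')
    have h4 := hΦs i
    rw [hend, hFg τ hτ' i, hFg (T k) hTk' i, Real.norm_of_nonneg (by linarith),
      Real.norm_of_nonneg (by linarith)]
    linarith
  -- Undoing `Φ (T k)` costs only bounded factors, since `Φ` and its inverse are bounded on `[0,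
  -- Tmax]`.
  have hgτ : g τ = Ψ (T k) *ᵥ (Φ (T k) *ᵥ g τ) := by
    rw [mulVec_mulVec, hΦ.inv_mul (T k) ⟨hTk.le, by linarith [hTT k]⟩, one_mulVec]
  calc ‖x (impulseTime T k + τ)‖ = ‖Φ τ *ᵥ g τ‖ := by rw [harc τ hτ]
    _ ≤ K₁ * ‖g τ‖ := (norm_mulVec_le _ _).trans
        (mul_le_mul_of_nonneg_right (hΦK τ ⟨hτ.1.le, hτ.2.trans (hTT k)⟩) (norm_nonneg _))
    _ ≤ K₁ * (K₂ * ‖x (impulseTime T (k + 1))‖) := by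
        refine mul_le_mul_of_nonneg_left ?_ hK₁
        rw [hgτ]
        exact (norm_mulVec_le _ _).trans
          (mul_le_mul (hΨK (T k) ⟨hTk.le, hTT k⟩) hnorm (norm_nonneg _) hK₂)
    _ = _ := by ring

end ImpulsiveDelay

/-! ### Splitting into nonnegative trajectories, and asymptotic stability. -/

namespace ImpulsiveDelay

variable {n pc pd qc qd : ℕ} {S : Sys n pc pd qc qd} {hc : ℝ} {hd : ℕ} {T : ℕ → ℝ}
  {Tmin Tmax ε γ : ℝ} {ζ : ℝ → Fin n → ℝ}

lemma delayedSample_sub (hd : ℕ) (T : ℕ → ℝ) (ψ₁ ψ₂ : Fin hd → Fin n → ℝ)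
    (x₁ x₂ : ℝ → Fin n → ℝ) (k : ℕ) : delayedSample hd T (ψ₁ - ψ₂) (x₁ - x₂) k =
      delayedSample hd T ψ₁ x₁ k - delayedSample hd T ψ₂ x₂ k := by
  unfold delayedSample
  split_ifs <;> rfl

lemma Sys.zc_sub (S : Sys n pc pd qc qd) (hc : ℝ) (w₁ w₂ : ℝ → Fin pc → ℝ)
    (x₁ x₂ : ℝ → Fin n → ℝ) (t : ℝ) :
    S.zc hc (w₁ - w₂) (x₁ - x₂) t = S.zc hc w₁ x₁ t - S.zc hc w₂ x₂ t := by
  simp only [Sys.zc, Pi.sub_apply, mulVec_sub]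
  abel

lemma Sys.zd_sub (S : Sys n pc pd qc qd) (hd : ℕ) (T : ℕ → ℝ) (ψ₁ ψ₂ : Fin hd → Fin n → ℝ)
    (w₁ w₂ : ℕ → Fin pd → ℝ) (x₁ x₂ : ℝ → Fin n → ℝ) (k : ℕ) :
    S.zd hd T (ψ₁ - ψ₂) (w₁ - w₂) (x₁ - x₂) k = S.zd hd T ψ₁ w₁ x₁ k - S.zd hd T ψ₂ w₂ x₂ k := by
  simp only [Sys.zd, delayedSample_sub, Pi.sub_apply, mulVec_sub]
  abel

lemma Sys.flow_sub (S : Sys n pc pd qc qd) (hc : ℝ) (T : ℕ → ℝ) (w₁ w₂ : ℝ → Fin pc → ℝ)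
    (x₁ x₂ : ℝ → Fin n → ℝ) (k : ℕ) :
    S.flow hc T (w₁ - w₂) (x₁ - x₂) k = fun τ => S.flow hc T w₁ x₁ k τ - S.flow hc T w₂ x₂ k τ := by
  ext1 τ
  simp only [Sys.flow, Pi.sub_apply, mulVec_sub]
  abel

lemma Sys.afterJump_sub (S : Sys n pc pd qc qd) (hd : ℕ) (T : ℕ → ℝ)
    (ψ₁ ψ₂ : Fin hd → Fin n → ℝ) (w₁ w₂ : ℕ → Fin pd → ℝ) (x₁ x₂ : ℝ → Fin n → ℝ) (k : ℕ) :
    S.afterJump hd T (ψ₁ - ψ₂) (w₁ - w₂) (x₁ - x₂) k =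
      S.afterJump hd T ψ₁ w₁ x₁ k - S.afterJump hd T ψ₂ w₂ x₂ k := by
  simp only [Sys.afterJump, delayedSample_sub, Pi.sub_apply, mulVec_sub]
  split_ifs
  · rfl
  · abel

lemma Sys.IsTrajectory.sub {φ₁ φ₂ : C(Icc (-hc) 0, Fin n → ℝ)} {ψ₁ ψ₂ : Fin hd → Fin n → ℝ}
    {w₁ w₂ : ℝ → Fin pc → ℝ} {v₁ v₂ : ℕ → Fin pd → ℝ} {x₁ x₂ : ℝ → Fin n → ℝ}
    (hT : ∀ k, 0 < T k) (h₁ : S.IsTrajectory hc hd T φ₁ ψ₁ w₁ v₁ x₁)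
    (h₂ : S.IsTrajectory hc hd T φ₂ ψ₂ w₂ v₂ x₂) :
    S.IsTrajectory hc hd T (φ₁ - φ₂) (ψ₁ - ψ₂) (w₁ - w₂) (v₁ - v₂) (x₁ - x₂) := by
  refine ⟨fun s => ?_, fun k => ?_, fun k τ hτ => ?_⟩
  · rw [Pi.sub_apply, h₁.init, h₂.init]
    rfl
  · rw [S.flow_sub]
    exact (h₁.integrable k).sub (h₂.integrable k)
  · have hsub : uIcc 0 τ ⊆ uIcc 0 (T k) := by
      rw [uIcc_of_le hτ.1.le, uIcc_of_le (hT k).le]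
      exact Icc_subset_Icc_right hτ.2
    rw [Pi.sub_apply, h₁.eq k τ hτ, h₂.eq k τ hτ, S.flow_sub, S.afterJump_sub,
      intervalIntegral.integral_sub ((h₁.integrable k).mono_set hsub)
        ((h₂.integrable k).mono_set hsub)]
    abel

/-- The pointwise positive part of a continuous vector-valued function. -/
noncomputable def posPartMap {X : Type*} [TopologicalSpace X] (φ : C(X, Fin n → ℝ)) :
    C(X, Fin n → ℝ) :=
  ⟨fun s => (φ s)⁺, continuous_pi fun i =>
    ((continuous_apply i).comp φ.continuous).sup continuous_const⟩

lemma posPartMap_nonneg {X : Type*} [TopologicalSpace X] (φ : C(X, Fin n → ℝ)) :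
    0 ≤ posPartMap φ := fun s => posPart_nonneg (φ s)

lemma posPartMap_sub {X : Type*} [TopologicalSpace X] (φ : C(X, Fin n → ℝ)) :
    posPartMap φ - φ = posPartMap (-φ) := by
  ext1 s
  change (φ s)⁺ - φ s = (-φ s)⁺
  rw [posPart_neg, sub_eq_iff_eq_add, ← sub_eq_iff_eq_add', posPart_sub_negPart]

lemma norm_posPart_le (φ : C(Icc (-hc) 0, Fin n → ℝ)) (ψ : Fin hd → Fin n → ℝ) :
    ‖(posPartMap φ, ψ⁺)‖ ≤ ‖(φ, ψ)‖ := by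
  have hv : ∀ v : Fin n → ℝ, ‖v⁺‖ ≤ ‖v‖ := fun v =>
    (pi_norm_le_iff_of_nonneg (norm_nonneg _)).2 fun i => by
      refine le_trans ?_ (norm_le_pi_norm v i)
      rw [Pi.posPart_apply, Real.norm_of_nonneg (posPart_nonneg _)]
      exact sup_le (le_abs_self _) (abs_nonneg _)
  refine max_le ?_ ?_
  · refine le_trans ((ContinuousMap.norm_le _ (norm_nonneg φ)).2 fun s => ?_) (norm_fst_le (φ, ψ))
    exact (hv (φ s)).trans (φ.norm_coe_le_norm s)
  · refine le_trans ((pi_norm_le_iff_of_nonneg (norm_nonneg ψ)).2 fun m => ?_) (norm_snd_le (φ, ψ))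
    exact (hv (ψ m)).trans (norm_le_pi_norm ψ m)

lemma norm_negPart_le (φ : C(Icc (-hc) 0, Fin n → ℝ)) (ψ : Fin hd → Fin n → ℝ) :
    ‖(posPartMap (-φ), ψ⁻)‖ ≤ ‖(φ, ψ)‖ := by
  have := norm_posPart_le (-φ) (-ψ)
  rwa [posPart_neg, ← Prod.neg_mk, norm_neg] at this

/-- Every trajectory is a difference of nonnegative trajectories. -/
lemma Sys.IsTrajectory.exists_eq_sub (hA : ContinuousOn S.A (Ici 0))
    (hG : ContinuousOn S.Gc (Ici 0)) (hE : ContinuousOn S.Ec (Ici 0))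
    (hhc : 0 < hc) (hT : T ∈ periodicRangeDwell Tmin Tmax hc) {φ : C(Icc (-hc) 0, Fin n → ℝ)}
    {ψ : Fin hd → Fin n → ℝ} {wc : ℝ → Fin pc → ℝ} {wd : ℕ → Fin pd → ℝ} {x : ℝ → Fin n → ℝ}
    (hwc : IntegrableOn wc (Ioi 0)) (hx : S.IsTrajectory hc hd T φ ψ wc wd x) :
    ∃ x₁ x₂, x = x₁ - x₂ ∧ S.IsTrajectory hc hd T (posPartMap φ) ψ⁺ wc⁺ wd⁺ x₁ ∧
      S.IsTrajectory hc hd T (posPartMap (-φ)) ψ⁻ wc⁻ wd⁻ x₂ ∧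
      IntegrableOn wc⁺ (Ioi 0) ∧ IntegrableOn wc⁻ (Ioi 0) := by
  have hp : IntegrableOn wc⁺ (Ioi 0) := Integrable.of_eval fun i => (Integrable.eval hwc i).pos_part
  have hn : IntegrableOn wc⁻ (Ioi 0) := Integrable.of_eval fun i => (Integrable.eval hwc i).neg_part
  obtain ⟨x₁, hx₁⟩ := S.exists_isTrajectory hA hG hE hhc
    (isDwellSeq_of_mem_periodicRangeDwell hhc hT) (le_of_mem_periodicRangeDwell hT)
    (posPartMap φ) ψ⁺ hp wd⁺
  -- Defining the second trajectory as `x₁ - x` avoids any appeal to uniqueness.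
  refine ⟨x₁, x₁ - x, (sub_sub_cancel _ _).symm, hx₁, ?_, hp, hn⟩
  have := hx₁.sub hT.1 hx
  rwa [posPartMap_sub,
    show ψ⁺ - ψ = ψ⁻ by rw [sub_eq_iff_eq_add, ← sub_eq_iff_eq_add', posPart_sub_negPart],
    show wc⁺ - wc = wc⁻ by rw [sub_eq_iff_eq_add, ← sub_eq_iff_eq_add', posPart_sub_negPart],
    show wd⁺ - wd = wd⁻ by rw [sub_eq_iff_eq_add, ← sub_eq_iff_eq_add', posPart_sub_negPart]]
    at this

lemma Sys.InternallyPositive.nonneg_of_mem_periodicRangeDwell (hpos : S.InternallyPositive)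
    (hhc : 0 < hc) (hT : T ∈ periodicRangeDwell Tmin Tmax hc) {φ : C(Icc (-hc) 0, Fin n → ℝ)}
    {ψ : Fin hd → Fin n → ℝ} {wc : ℝ → Fin pc → ℝ} {wd : ℕ → Fin pd → ℝ} {x : ℝ → Fin n → ℝ}
    (hwc : IntegrableOn wc (Ioi 0)) (hx : S.IsTrajectory hc hd T φ ψ wc wd x) (hφ : 0 ≤ φ)
    (hψ : 0 ≤ ψ) (hwc0 : 0 ≤ wc) (hwd0 : 0 ≤ wd) :
    (∀ t, 0 ≤ t → 0 ≤ x t) ∧ (∀ t, 0 < t → 0 ≤ S.zc hc wc x t) ∧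
      (∀ k, 1 ≤ k → 0 ≤ S.zd hd T ψ wd x k) :=
  hpos hc hd T hhc (isDwellSeq_of_mem_periodicRangeDwell hhc hT) φ ψ wc wd x
    ((integrableOn_Ici_iff_integrableOn_Ioi (by simp)).2 hwc).locallyIntegrableOn hx hφ hψ
    (fun t _ => hwc0 t) (fun k _ => hwd0 k)

lemma integral_one_dotProduct_nonneg {m : ℕ} {f : ℝ → Fin m → ℝ} {b : ℝ} (hb : 0 ≤ b)
    (hf : ∀ τ ∈ Ioc 0 b, 0 ≤ f τ) : 0 ≤ ∫ τ in (0 : ℝ)..b, 1 ⬝ᵥ f τ := by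
  rw [intervalIntegral.integral_of_le hb]
  exact setIntegral_nonneg measurableSet_Ioc fun τ hτ =>
    dotProduct_nonneg_of_nonneg (fun _ => zero_le_one) (hf τ hτ)

namespace Sys.IsCertificate

/-- Without inputs the `ε` term makes `1 ⬝ᵥ x (t_k)` summable, with sum at most `K / ε` times the
initial norm. This bounds the samples and sends them to 0; `exists_norm_le` carries both facts to
all times. -/
lemma bound_and_tendsto_of_nonneg (h : S.IsCertificate Tmin Tmax ζ ε γ)
    (hpos : S.InternallyPositive) (hA : ContinuousOn S.A (Ici 0)) (hG : ContinuousOn S.Gc (Ici 0))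
    (hE : ContinuousOn S.Ec (Ici 0)) (hε : 0 < ε) (hTmax : 0 ≤ Tmax) (hTT : Tmin ≤ Tmax)
    (hhc : 0 < hc) (hd : ℕ) :
    ∃ C, 0 ≤ C ∧ ∀ T ∈ periodicRangeDwell Tmin Tmax hc, ∀ (φ : C(Icc (-hc) 0, Fin n → ℝ))
      (ψ : Fin hd → Fin n → ℝ) (x : ℝ → Fin n → ℝ), S.IsTrajectory hc hd T φ ψ 0 0 x → 0 ≤ φ →
      0 ≤ ψ → (∀ t, 0 ≤ t → ‖x t‖ ≤ C * ‖(φ, ψ)‖) ∧ Tendsto x atTop (𝓝 0) := by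
  obtain ⟨K, hK, hsum⟩ := h.sum_le_of_nonneg hpos hA hG hE hε hTT hhc hd
  obtain ⟨C, hC, hbetween⟩ := hpos.exists_norm_le hA hG hE hTmax hhc.le hd
  -- The `+ 1` covers `t = 0`, which lies in no interval `(t_k, t_{k+1}]`.
  refine ⟨C * (K / ε) + 1, by positivity, fun T hT φ ψ x hx hφ hψ => ?_⟩
  have hdw := isDwellSeq_of_mem_periodicRangeDwell hhc hT
  have hint : IntegrableOn (0 : ℝ → Fin pc → ℝ) (Ioi 0) := integrable_zero _ _ _
  obtain ⟨hx0, hz, hzd⟩ := hpos.nonneg_of_mem_periodicRangeDwell hhc hT hint hx hφ hψ le_rfl le_rfl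
  set R := ‖(φ, ψ)‖ with hR
  have hR0 : 0 ≤ R := norm_nonneg _
  set u : ℕ → ℝ := fun k => 1 ⬝ᵥ x (impulseTime T (k + 1)) with hu
  have hxk : ∀ k, 0 ≤ x (impulseTime T k) := fun k => hx0 _ (impulseTime_nonneg hT.1 k)
  have hu0 : ∀ k, 0 ≤ u k := fun k =>
    dotProduct_nonneg_of_nonneg (fun _ => zero_le_one) (hxk (k + 1))
  have husum : ∀ M, ∑ k ∈ Finset.range M, u k ≤ K * R / ε := fun M => by
    rw [le_div_iff₀ hε, mul_comm, Finset.mul_sum]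
    have h1 := hsum T hT φ ψ 0 0 x hint hx hφ hψ (fun _ _ => le_rfl) (fun _ _ => le_rfl) hx0 M
    simp only [Pi.zero_apply, dotProduct_zero, intervalIntegral.integral_zero, add_zero, mul_zero,
      Finset.sum_const_zero, zero_add] at h1
    refine le_trans (Finset.sum_le_sum fun k _ => ?_) h1
    have h2 : 0 ≤ ∫ τ in (0 : ℝ)..T k, 1 ⬝ᵥ S.zc hc 0 x (impulseTime T k + τ) :=
      integral_one_dotProduct_nonneg (hT.1 k).le fun τ hτ =>
        hz _ (add_pos_of_nonneg_of_pos (impulseTime_nonneg hT.1 k) hτ.1)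
    have h3 : 0 ≤ 1 ⬝ᵥ S.zd hd T ψ 0 x (k + 1) :=
      dotProduct_nonneg_of_nonneg (fun _ => zero_le_one) (hzd (k + 1) (by omega))
    simp only [hu]
    linarith
  have hbd : ∀ k, ∀ τ ∈ Ioc 0 (T k), ‖x (impulseTime T k + τ)‖ ≤ C * u k := fun k τ hτ =>
    (hbetween T hT.1 (fun k => (mem_Icc_of_mem_periodicRangeDwell hT k).2) φ ψ x hx hφ hx0 k τ
      hτ).trans (mul_le_mul_of_nonneg_left (norm_le_one_dotProduct (hxk (k + 1))) hC)
  refine ⟨fun t ht => ?_, ?_⟩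
  · rcases ht.eq_or_lt with rfl | ht
    · have h1 := hx.norm_le_of_mem_Icc (s := 0) ⟨by linarith, le_rfl⟩
      have h2 : 0 ≤ C * (K / ε) * R := by positivity
      linarith
    · obtain ⟨k, hk⟩ := hdw.exists_mem_Ioc ht
      have h1 := hbd k _ hk
      rw [add_sub_cancel] at h1
      have h2 : u k ≤ K * R / ε := (Finset.single_le_sum (f := u) (fun i _ => hu0 i)
        (Finset.mem_range.2 k.lt_succ_self)).trans (husum (k + 1))
      have h3 := mul_le_mul_of_nonneg_left h2 hC
      have h4 : C * (K * R / ε) = C * (K / ε) * R := by ring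
      linarith
  · have hsu : Summable u := summable_of_sum_range_le hu0 husum
    have hlim : Tendsto (fun k => C * u k) atTop (𝓝 0) := by
      simpa using hsu.tendsto_atTop_zero.const_mul C
    rw [tendsto_zero_iff_norm_tendsto_zero, Metric.tendsto_atTop]
    intro η hη
    obtain ⟨k₀, hk₀⟩ := Filter.eventually_atTop.1 (hlim.eventually_lt_const hη)
    refine ⟨impulseTime T k₀ + 1, fun t ht => ?_⟩
    have ht0 : 0 < t := by linarith [impulseTime_nonneg hT.1 k₀]
    obtain ⟨k, hk⟩ := hdw.exists_mem_Ioc ht0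
    have hkk : k₀ ≤ k := by
      by_contra hlt
      have h1 := impulseTime_mono hT.1 (show k + 1 ≤ k₀ by omega)
      rw [impulseTime_succ] at h1
      linarith [hk.2]
    have h1 := hbd k _ hk
    rw [add_sub_cancel] at h1
    simpa using h1.trans_lt (hk₀ k hkk)

theorem asymptoticallyStable (h : S.IsCertificate Tmin Tmax ζ ε γ)
    (hpos : S.InternallyPositive) (hA : ContinuousOn S.A (Ici 0)) (hG : ContinuousOn S.Gc (Ici 0))
    (hE : ContinuousOn S.Ec (Ici 0)) (hε : 0 < ε) (hTmax : 0 ≤ Tmax) (hTT : Tmin ≤ Tmax)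
    (hhc : 0 < hc) (hd : ℕ) :
    S.AsymptoticallyStable hc hd (periodicRangeDwell Tmin Tmax hc) := by
  obtain ⟨C, hC, hnonneg⟩ := h.bound_and_tendsto_of_nonneg hpos hA hG hE hε hTmax hTT hhc hd
  have key : ∀ T ∈ periodicRangeDwell Tmin Tmax hc, ∀ (φ : C(Icc (-hc) 0, Fin n → ℝ))
      (ψ : Fin hd → Fin n → ℝ) (x : ℝ → Fin n → ℝ), S.IsTrajectory hc hd T φ ψ 0 0 x →
      (∀ t, 0 ≤ t → ‖x t‖ ≤ 2 * C * ‖(φ, ψ)‖) ∧ Tendsto x atTop (𝓝 0) := by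
    intro T hT φ ψ x hx
    obtain ⟨x₁, x₂, rfl, hx₁, hx₂, -, -⟩ := hx.exists_eq_sub hA hG hE hhc hT
      (integrable_zero _ _ _)
    rw [posPart_zero, posPart_zero] at hx₁
    rw [negPart_zero, negPart_zero] at hx₂
    obtain ⟨hb₁, ht₁⟩ := hnonneg T hT _ _ x₁ hx₁ (posPartMap_nonneg φ) (posPart_nonneg ψ)
    obtain ⟨hb₂, ht₂⟩ := hnonneg T hT _ _ x₂ hx₂ (posPartMap_nonneg (-φ)) (negPart_nonneg ψ)
    refine ⟨fun t ht => ?_, ?_⟩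
    · have h1 := (hb₁ t ht).trans (mul_le_mul_of_nonneg_left (norm_posPart_le φ ψ) hC)
      have h2 := (hb₂ t ht).trans (mul_le_mul_of_nonneg_left (norm_negPart_le φ ψ) hC)
      have h3 := norm_sub_le (x₁ t) (x₂ t)
      rw [Pi.sub_apply]
      linarith
    · have := ht₁.sub ht₂
      rwa [sub_zero] at this
  -- The `+ 1` keeps the denominator positive when `C = 0`.
  refine ⟨fun η hη => ⟨η / (2 * C + 1), by positivity, fun T hT φ ψ x hx hlt t ht => ?_⟩,
    fun T hT φ ψ x hx => (key T hT φ ψ x hx).2⟩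
  rw [lt_div_iff₀ (by positivity)] at hlt
  have h1 := (key T hT φ ψ x hx).1 t ht
  by_cases h0 : ‖(φ, ψ)‖ = 0
  · rw [h0, mul_zero] at h1
    linarith
  · have : 0 < ‖(φ, ψ)‖ := lt_of_le_of_ne (norm_nonneg _) (Ne.symm h0)
    linarith

end Sys.IsCertificate

end ImpulsiveDelay

/-! ### The hybrid gain. -/

namespace ImpulsiveDelay

variable {n pc pd qc qd : ℕ} {S : Sys n pc pd qc qd} {hc : ℝ} {hd : ℕ} {T : ℕ → ℝ}
  {Tmin Tmax ε γ : ℝ} {ζ : ℝ → Fin n → ℝ}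

lemma IsDwellSeq.lintegral_eq_tsum (hT : IsDwellSeq T) (f : ℝ → ℝ≥0∞) :
    ∫⁻ t in Ioi (0 : ℝ), f t =
      ∑' k, ∫⁻ t in Ioc (impulseTime T k) (impulseTime T k + T k), f t := by
  have hunion : Ioi (0 : ℝ) = ⋃ k, Ioc (impulseTime T k) (impulseTime T k + T k) := by
    ext t
    simp only [mem_Ioi, mem_iUnion]
    refine ⟨fun ht => ?_, fun ⟨k, hk⟩ => (impulseTime_nonneg hT.1 k).trans_lt hk.1⟩
    obtain ⟨k, hk⟩ := hT.exists_mem_Ioc ht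
    exact ⟨k, by linarith [hk.1], by linarith [hk.2]⟩
  have hdisj : Pairwise (Function.onFun Disjoint
      fun k => Ioc (impulseTime T k) (impulseTime T k + T k)) := by
    simp only [← impulseTime_succ]
    exact (impulseTime_mono hT.1).pairwise_disjoint_on_Ioc_succ
  rw [hunion, lintegral_iUnion (fun _ => measurableSet_Ioc) hdisj]

lemma lintegral_Ioc_eq_ofReal {f : ℝ → ℝ} {t b : ℝ} (hb : 0 ≤ b)
    (hf : IntervalIntegrable (fun τ => f (t + τ)) volume 0 b)
    (hf0 : ∀ τ ∈ Ioc 0 b, 0 ≤ f (t + τ)) :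
    ∫⁻ s in Ioc t (t + b), ENNReal.ofReal (f s) =
      ENNReal.ofReal (∫ τ in (0 : ℝ)..b, f (t + τ)) := by
  have hint : IntervalIntegrable f volume t (t + b) := by
    have := hf.comp_sub_right t
    simpa [add_comm b] using this
  rw [intervalIntegral.integral_comp_add_left, add_zero,
    intervalIntegral.integral_of_le (by linarith), ofReal_integral_eq_lintegral_ofReal hint.1]
  refine (ae_restrict_iff' measurableSet_Ioc).2 (ae_of_all _ fun s hs => ?_)
  have := hf0 (s - t) ⟨by linarith [hs.1], by linarith [hs.2]⟩
  rwa [add_sub_cancel] at this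

lemma sum_enorm_sub_le {m : ℕ} {u v : Fin m → ℝ} (hu : 0 ≤ u) (hv : 0 ≤ v) :
    ∑ i, ‖(u - v) i‖ₑ ≤ ENNReal.ofReal (1 ⬝ᵥ u + 1 ⬝ᵥ v) := by
  rw [one_dotProduct, one_dotProduct, ← Finset.sum_add_distrib,
    ENNReal.ofReal_sum_of_nonneg fun i _ => add_nonneg (hu i) (hv i)]
  refine Finset.sum_le_sum fun i _ => ?_
  rw [Real.enorm_eq_ofReal_abs]
  refine ENNReal.ofReal_le_ofReal ?_
  have h1 := hu i
  have h2 := hv i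
  simp only [Pi.zero_apply] at h1 h2
  rw [Pi.sub_apply, abs_le]
  constructor <;> linarith

/-- An equality, so that splitting the inputs costs no factor in `γ`; for the outputs the triangle
inequality `sum_enorm_sub_le` suffices. -/
lemma ofReal_one_dotProduct_posPart_add_negPart {m : ℕ} (v : Fin m → ℝ) :
    ENNReal.ofReal (1 ⬝ᵥ v⁺ + 1 ⬝ᵥ v⁻) = ∑ i, ‖v i‖ₑ := by
  rw [← dotProduct_add, posPart_add_negPart, one_dotProduct,
    ENNReal.ofReal_sum_of_nonneg fun i _ => abs_nonneg v i]
  simp only [Real.enorm_eq_ofReal_abs, Pi.abs_apply]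

namespace Sys.IsCertificate

theorem hasHybridGainAtMost (h : S.IsCertificate Tmin Tmax ζ ε γ)
    (hpos : S.InternallyPositive) (hA : ContinuousOn S.A (Ici 0)) (hG : ContinuousOn S.Gc (Ici 0))
    (hE : ContinuousOn S.Ec (Ici 0)) (hε : 0 < ε) (hγ : 0 ≤ γ) (hTT : Tmin ≤ Tmax)
    (hhc : 0 < hc) (hd : ℕ) :
    S.HasHybridGainAtMost hc hd (periodicRangeDwell Tmin Tmax hc) γ := by
  obtain ⟨K, hK, hsum⟩ := h.sum_le_of_nonneg hpos hA hG hE hε hTT hhc hd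
  have hK1 : 0 < 2 * K + 1 := by positivity
  -- Each of the two nonnegative trajectories contributes `K`; the `+ 1` keeps the bias strictly
  -- increasing and unbounded when `K = 0`.
  refine ⟨fun s => (2 * K + 1) * s, (strictMono_mul_left_of_pos hK1).strictMonoOn _,
    mul_zero _, tendsto_id.const_mul_atTop hK1, fun T hT φ ψ wc wd x hwc _ hx => ?_⟩
  have hdw := isDwellSeq_of_mem_periodicRangeDwell hhc hT
  obtain ⟨x₁, x₂, rfl, hx₁, hx₂, hp, hn⟩ := hx.exists_eq_sub hA hG hE hhc hT hwc
  obtain ⟨hx₁0, hz₁, hzd₁⟩ := hpos.nonneg_of_mem_periodicRangeDwell hhc hT hp hx₁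
    (posPartMap_nonneg φ) (posPart_nonneg ψ) (posPart_nonneg wc) (posPart_nonneg wd)
  obtain ⟨hx₂0, hz₂, hzd₂⟩ := hpos.nonneg_of_mem_periodicRangeDwell hhc hT hn hx₂
    (posPartMap_nonneg (-φ)) (negPart_nonneg ψ) (negPart_nonneg wc) (negPart_nonneg wd)
  have hs₁ := hsum T hT _ _ _ _ x₁ hp hx₁ (posPartMap_nonneg φ) (posPart_nonneg ψ)
    (fun t _ => posPart_nonneg wc t) (fun k _ => posPart_nonneg wd k) hx₁0
  have hs₂ := hsum T hT _ _ _ _ x₂ hn hx₂ (posPartMap_nonneg (-φ)) (negPart_nonneg ψ)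
    (fun t _ => negPart_nonneg wc t) (fun k _ => negPart_nonneg wd k) hx₂0
  set R := ‖(φ, ψ)‖ with hR
  have hR₁ := mul_le_mul_of_nonneg_left (norm_posPart_le φ ψ) hK
  have hR₂ := mul_le_mul_of_nonneg_left (norm_negPart_le φ ψ) hK
  have htk := impulseTime_nonneg hT.1
  have hTk : ∀ k, 0 ≤ T k := fun k => (hT.1 k).le
  -- the outputs
  set Z : ℕ → ℝ := fun k =>
    (∫ τ in (0 : ℝ)..T k, 1 ⬝ᵥ S.zc hc wc⁺ x₁ (impulseTime T k + τ)) +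
    ∫ τ in (0 : ℝ)..T k, 1 ⬝ᵥ S.zc hc wc⁻ x₂ (impulseTime T k + τ) with hZ
  set Y : ℕ → ℝ := fun k =>
    1 ⬝ᵥ S.zd hd T ψ⁺ wd⁺ x₁ (k + 1) + 1 ⬝ᵥ S.zd hd T ψ⁻ wd⁻ x₂ (k + 1) with hY
  have hpt : ∀ k, ∀ τ ∈ Ioc 0 (T k), 0 < impulseTime T k + τ := fun k τ hτ =>
    add_pos_of_nonneg_of_pos (htk k) hτ.1
  have hone0 : ∀ {m : ℕ}, (0 : Fin m → ℝ) ≤ 1 := fun _ => zero_le_one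
  have hZ0 : ∀ k, 0 ≤ Z k := fun k => add_nonneg
    (integral_one_dotProduct_nonneg (hTk k) fun τ hτ => hz₁ _ (hpt k τ hτ))
    (integral_one_dotProduct_nonneg (hTk k) fun τ hτ => hz₂ _ (hpt k τ hτ))
  have hY0 : ∀ k, 0 ≤ Y k := fun k => add_nonneg
    (dotProduct_nonneg_of_nonneg hone0 (hzd₁ (k + 1) (by omega)))
    (dotProduct_nonneg_of_nonneg hone0 (hzd₂ (k + 1) (by omega)))
  have hzc : ∀ t, S.zc hc wc (x₁ - x₂) t = S.zc hc wc⁺ x₁ t - S.zc hc wc⁻ x₂ t := fun t => by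
    rw [← S.zc_sub, posPart_sub_negPart]
  have hzd : ∀ k, S.zd hd T ψ wd (x₁ - x₂) k =
      S.zd hd T ψ⁺ wd⁺ x₁ k - S.zd hd T ψ⁻ wd⁻ x₂ k := fun k => by
    rw [← S.zd_sub, posPart_sub_negPart, posPart_sub_negPart]
  have hZle : ∀ k, ∫⁻ t in Ioc (impulseTime T k) (impulseTime T k + T k),
      ∑ i, ‖S.zc hc wc (x₁ - x₂) t i‖ₑ ≤ ENNReal.ofReal (Z k) := fun k => by
    have i₁ := intervalIntegrable_dotProduct (v := fun _ => 1) continuousOn_const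
      (hx₁.intervalIntegrable_zc hhc.le hT.1 hp k)
    have i₂ := intervalIntegrable_dotProduct (v := fun _ => 1) continuousOn_const
      (hx₂.intervalIntegrable_zc hhc.le hT.1 hn k)
    simp only [hZ]
    rw [← intervalIntegral.integral_add i₁ i₂, ← lintegral_Ioc_eq_ofReal
      (f := fun t => 1 ⬝ᵥ S.zc hc wc⁺ x₁ t + 1 ⬝ᵥ S.zc hc wc⁻ x₂ t) (hTk k) (i₁.add i₂)
      fun τ hτ => add_nonneg (dotProduct_nonneg_of_nonneg hone0 (hz₁ _ (hpt k τ hτ)))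
        (dotProduct_nonneg_of_nonneg hone0 (hz₂ _ (hpt k τ hτ)))]
    refine setLIntegral_mono' measurableSet_Ioc fun t ht => ?_
    have ht0 : 0 < t := (htk k).trans_lt ht.1
    rw [hzc t]
    exact sum_enorm_sub_le (hz₁ t ht0) (hz₂ t ht0)
  have hYle : ∀ k, ∑ i, ‖S.zd hd T ψ wd (x₁ - x₂) (k + 1) i‖ₑ ≤ ENNReal.ofReal (Y k) := fun k => by
    rw [hzd (k + 1)]
    exact sum_enorm_sub_le (hzd₁ (k + 1) (by omega)) (hzd₂ (k + 1) (by omega))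
  -- the inputs
  set W : ℕ → ℝ := fun k =>
    (∫ τ in (0 : ℝ)..T k, 1 ⬝ᵥ wc⁺ (impulseTime T k + τ)) +
    ∫ τ in (0 : ℝ)..T k, 1 ⬝ᵥ wc⁻ (impulseTime T k + τ) with hW
  set V : ℕ → ℝ := fun k => 1 ⬝ᵥ wd⁺ (k + 1) + 1 ⬝ᵥ wd⁻ (k + 1) with hV
  have hW0 : ∀ k, 0 ≤ W k := fun k => add_nonneg
    (integral_one_dotProduct_nonneg (hTk k) fun τ _ => posPart_nonneg wc _)
    (integral_one_dotProduct_nonneg (hTk k) fun τ _ => negPart_nonneg wc _)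
  have hV0 : ∀ k, 0 ≤ V k := fun k => add_nonneg
    (dotProduct_nonneg_of_nonneg hone0 (posPart_nonneg wd (k + 1)))
    (dotProduct_nonneg_of_nonneg hone0 (negPart_nonneg wd (k + 1)))
  have hWeq : ∀ k, ENNReal.ofReal (W k) =
      ∫⁻ t in Ioc (impulseTime T k) (impulseTime T k + T k), ∑ i, ‖wc t i‖ₑ := fun k => by
    have i₁ := intervalIntegrable_dotProduct (v := fun _ => 1) continuousOn_const
      (intervalIntegrable_input hp (htk k) (hTk k))
    have i₂ := intervalIntegrable_dotProduct (v := fun _ => 1) continuousOn_const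
      (intervalIntegrable_input hn (htk k) (hTk k))
    simp only [hW]
    rw [← intervalIntegral.integral_add i₁ i₂, ← lintegral_Ioc_eq_ofReal
      (f := fun t => 1 ⬝ᵥ wc⁺ t + 1 ⬝ᵥ wc⁻ t) (hTk k) (i₁.add i₂)
      fun τ _ => add_nonneg (dotProduct_nonneg_of_nonneg hone0 (posPart_nonneg wc _))
        (dotProduct_nonneg_of_nonneg hone0 (negPart_nonneg wc _))]
    exact lintegral_congr fun t => ofReal_one_dotProduct_posPart_add_negPart (wc t)
  have hVeq : ∀ k, ENNReal.ofReal (V k) = ∑ i, ‖wd (k + 1) i‖ₑ := fun k =>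
    ofReal_one_dotProduct_posPart_add_negPart (wd (k + 1))
  have hreal : ∀ M, ∑ k ∈ Finset.range M, (Z k + Y k) ≤
      γ * ∑ k ∈ Finset.range M, (W k + V k) + (2 * K + 1) * R := fun M => by
    have h₁ := hs₁ M
    have h₂ := hs₂ M
    have hdrop : ∀ x : ℝ → Fin n → ℝ, (∀ t, 0 ≤ t → 0 ≤ x t) →
        0 ≤ ∑ k ∈ Finset.range M, ε * 1 ⬝ᵥ x (impulseTime T (k + 1)) := fun x hx =>
      Finset.sum_nonneg fun k _ => mul_nonneg hε.le
        (dotProduct_nonneg_of_nonneg hone0 (hx _ (htk _)))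
    have hd₁ := hdrop x₁ hx₁0
    have hd₂ := hdrop x₂ hx₂0
    have hR0 : 0 ≤ R := norm_nonneg _
    rw [Finset.mul_sum]
    simp only [hZ, hY, hW, hV, mul_add, Finset.sum_add_distrib] at h₁ h₂ ⊢
    linarith
  rw [normL1, normL1, normEll1, normEll1, hdw.lintegral_eq_tsum, hdw.lintegral_eq_tsum,
    ← ENNReal.tsum_add, ← ENNReal.tsum_add]
  -- Bounding partial sums in `ℝ≥0∞` yields finiteness of the output norms together with the gain.
  refine ENNReal.tsum_le_of_sum_range_le fun M => ?_
  calc ∑ k ∈ Finset.range M, (_ + _)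
      ≤ ∑ k ∈ Finset.range M, ENNReal.ofReal (Z k + Y k) := Finset.sum_le_sum fun k _ => by
        rw [ENNReal.ofReal_add (hZ0 k) (hY0 k)]
        exact add_le_add (hZle k) (hYle k)
    _ = ENNReal.ofReal (∑ k ∈ Finset.range M, (Z k + Y k)) :=
        (ENNReal.ofReal_sum_of_nonneg fun k _ => add_nonneg (hZ0 k) (hY0 k)).symm
    _ ≤ ENNReal.ofReal (γ * ∑ k ∈ Finset.range M, (W k + V k) + (2 * K + 1) * R) :=
        ENNReal.ofReal_le_ofReal (hreal M)
    _ ≤ ENNReal.ofReal (γ * ∑ k ∈ Finset.range M, (W k + V k)) +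
          ENNReal.ofReal ((2 * K + 1) * R) := ENNReal.ofReal_add_le
    _ ≤ _ := by
        refine add_le_add ?_ le_rfl
        rw [ENNReal.ofReal_mul hγ,
          ENNReal.ofReal_sum_of_nonneg fun k _ => add_nonneg (hW0 k) (hV0 k)]
        refine mul_le_mul_right ((Finset.sum_le_sum fun k _ => ?_).trans
          (ENNReal.sum_le_tsum (Finset.range M))) _
        rw [ENNReal.ofReal_add (hW0 k) (hV0 k), hWeq, hVeq]

end Sys.IsCertificate

end ImpulsiveDelay

theorem mainTheorem7 {n pc pd qc qd : ℕ} (S : ImpulsiveDelay.Sys n pc pd qc qd)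
    (hA : ContinuousOn S.A (Set.Ici 0)) (hG : ContinuousOn S.Gc (Set.Ici 0))
    (hE : ContinuousOn S.Ec (Set.Ici 0)) (hpos : S.InternallyPositive)
    (Tmin Tmax : ℝ) (hTmin : 0 ≤ Tmin) (hT : Tmin ≤ Tmax)
    (ζ : ℝ → Fin n → ℝ) (hζ : DifferentiableOn ℝ ζ (Set.Icc 0 Tmax)) (hζ0 : ∀ i, 0 < ζ 0 i)
    (ε γ : ℝ) (hε : 0 < ε) (hγ : 0 < γ)
    (hflow_state : ∀ τ ∈ Set.Icc 0 Tmax,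
      derivWithin ζ (Set.Icc 0 Tmax) τ + ζ τ ᵥ* (S.A τ + S.Gc τ) + 1 ᵥ* (S.Cc + S.Hc) ≤ 0)
    (hflow_input : ∀ τ ∈ Set.Icc 0 Tmax,
      ζ τ ᵥ* S.Ec τ + 1 ᵥ* S.Fc ≤ fun _ => γ)
    (hjump_state : ∀ θ ∈ Set.Icc Tmin Tmax,
      -ζ θ + ζ 0 ᵥ* (S.J + S.Gd) + 1 ᵥ* (S.Cd + S.Hd) ≤ fun _ => -ε)
    (hjump_input : ζ 0 ᵥ* S.Ed + 1 ᵥ* S.Fd ≤ fun _ => γ) :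
    ∀ (hc : ℝ) (hd : ℕ), 0 < hc →
      S.AsymptoticallyStable hc hd (ImpulsiveDelay.periodicRangeDwell Tmin Tmax hc) ∧
      S.HasHybridGainAtMost hc hd (ImpulsiveDelay.periodicRangeDwell Tmin Tmax hc) γ := by
  intro hc hd hhc
  have h : S.IsCertificate Tmin Tmax ζ ε γ :=
    ⟨hζ, hζ0, hflow_state, hflow_input, hjump_state, hjump_input⟩
  exact ⟨h.asymptoticallyStable hpos hA hG hE hε (hTmin.trans hT) hT hhc hd,
    h.hasHybridGainAtMost hpos hA hG hE hε hγ.le hT hhc hd⟩
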